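/- **Setting.** Let $\mathbb S$ be a collection of nonempty subsets (assortments) of $[N]=\{1,\dots,N\}$. A choice model $p$ gives for each $s\in\mathbb S$ a probability mass function $p(\cdot|s)$ on $[N]\cup\{0\}$ carried by $s\cup\{0\}$. Let $r(s,a)\ge 0$ be known revenues, $\mathcal V(s;p)=\sum_{a\in s}p(a|s)r(s,a)$, and let $\mathcal P$ be a family of choice models with $p_0\in\mathcal P$. Let $s^\star\in\arg\max_{s\in\mathbb S}\mathcal V(s;p_0)$ and $r_{s^\star}=\max_{j\in s^\star}r(s^\star,j)$. Let $\pi_S$ be a probability mass function on $\mathbb S$ with $\pi_S(s^\star)>0$, and let $(S_i,A_i)_{i=1}^n$, $n\ge1$, be i.i.d. with probability mass function $(s,a)\mapsto\pi_S(s)p_0(a|s)$. Let $\widehat L_n(p)=-\frac1n\sum_{i=1}^n\log p(A_i|S_i)\in[0,+\infty]$ and $\Omega_n(\alpha)=\{p\in\mathcal P:\widehat L_n(p)\le\inf_{q\in\mathcal P}\widehat L_n(q)+\alpha\}$ (the infimum is $\widehat L_n(\widehat p_n)$ if a maximum likelihood estimator $\widehat p_n\in\mathcal P$ exists). PASTA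 with the uncertainty set $\Omega_n(\alpha)$ outputs any $\widehat s_{\mathfrak p,n}\in\arg\max_{s\in\mathbb S}\inf_{p\in\Omega_n(\alpha)}\mathcal V(s;p)$. Its regret is $\mathcal R(\widehat s_{\mathfrak p,n})=\mathcal V(s^\star;p_0)-\mathcal V(\widehat s_{\mathfrak p,n};p_0)$. For functions $b_1,b_2\ge0$ of $(s,a)$ let $H^2(b_1,b_2)=\sum_{s\in\mathbb S}\pi_S(s)\,\frac12\sum_{a\in s\cup\{0\}}\big(\sqrt{b_1(a|s)}-\sqrt{b_2(a|s)}\big)^2$. Let $\mathcal N_{[]}(\varepsilon,\mathcal P,H)$ be the smallest cardinality of a set $\mathcal B$ of functions $\mathbb S\times([N]\cup\{0\})\to[0,1]$ such that for every $p\in\mathcal P$ there are $b_1,b_2\in\mathcal B$ with $H(b_1,b_2)\le\varepsilon$ and $b_1\le p\le b_2$ pointwise. **Constants.** Let $\kappa(u)=2(e^{|u|/2}-1-|u|/2)/(1-e^{-u/2})^2$ for $u\ne0$, and $\kappa(0)=1$. Fix $\tau>0$ with $\kappa(\tau)<8(1-e^{-\tau})^2$ (for instance $\tau=2$), and put $C_1=2^{-7}\kappa(\tau)$,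 $C_2=2\sqrt{2\kappa(\tau)}$, $C_3=2\sqrt2\,e^{\tau/2}$, $C_4=2^{-24}\kappa(\tau)$, $C_6=2\cdot\frac{63}{257\cdot2^{14}}$. **Statement.** There are constants $C_5,C>0$, depending on nothing but $\tau$, such that in every setting as above the following holds. If $\alpha_n^\circ>0$ satisfies the balance equation $$\int_{C_1\alpha_n^\circ}^{C_2\sqrt{\alpha_n^\circ}}\sqrt{\log\mathcal N_{[]}(u/C_3,\mathcal P,H)}\,\mathrm du\le C_4\sqrt n\,\alpha_n^\circ,$$ $0<\delta<1$, and $\alpha_n(\delta)=\alpha_n^\circ+\frac1{C_6n}\log\frac{C_5}{\delta}$, then with probability at least $1-\delta$ the regret of PASTA with the uncertainty set $\Omega_n(\alpha_n(\delta))$ satisfies $$\mathcal R(\widehat s_{\mathfrak p,n})\le C\,r_{s^\star}\sqrt{\frac{\alpha_n(\delta)}{\pi_S(s^\star)}}.$$ -/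

import Mathlib

open MeasureTheory ProbabilityTheory
open scoped ENNReal

noncomputable section

namespace Pasta

/-- Conditional functions `(s, a) ↦ p(a|s)`, for `s` in the collection `𝕊` of assortments and `a` in
`[N] ∪ {0}`. The items are `Fin N`, and `none` is the no-purchase option `0`. -/
abbrev CondFun {N : ℕ} (𝕊 : Finset (Finset (Fin N))) : Type := 𝕊 → Option (Fin N) → ℝ

/-- An observation: the offered assortment and the customer's choice. -/
def Obs {N : ℕ} (𝕊 : Finset (Finset (Fin N))) : Type := 𝕊 × Option (Fin N)

instance {N : ℕ} (𝕊 : Finset (Finset (Fin N))) : MeasurableSpace (Obs 𝕊) := ⊤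

variable {N : ℕ} {𝕊 : Finset (Finset (Fin N))}

/-- `p(·|s)` is a probability mass function carried by `s ∪ {0}`, for every assortment `s`. -/
structure IsChoiceModel (p : CondFun 𝕊) : Prop where
  nonneg : ∀ s a, 0 ≤ p s a
  eq_zero : ∀ (s : 𝕊) (a : Fin N), a ∉ s.1 → p s (some a) = 0
  sum_eq_one : ∀ s : 𝕊, ∑ a ∈ Finset.insertNone s.1, p s a = 1

/-- `π` is a probability mass function on `𝕊`. -/
structure IsAssortmentLaw (π : 𝕊 → ℝ) : Prop where
  nonneg : ∀ s, 0 ≤ π s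
  sum_eq_one : ∑ s, π s = 1

/-- The expected revenue `𝒱(s; p) = ∑_{a ∈ s} p(a|s) r(s, a)`. -/
def value (r : 𝕊 → Fin N → ℝ) (s : 𝕊) (p : CondFun 𝕊) : ℝ :=
  ∑ a ∈ s.1, p s (some a) * r s a

/-- `s` maximizes the expected revenue under the model `p`. -/
def IsOptimalAssortment (r : 𝕊 → Fin N → ℝ) (p : CondFun 𝕊) (s : 𝕊) : Prop :=
  ∀ s', value r s' p ≤ value r s p

/-- The maximal revenue `r_s = max_{j ∈ s} r(s, j)`. -/
def maxRevenue (r : 𝕊 → Fin N → ℝ) (s : 𝕊) : ℝ := ⨆ j : s.1, r s j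

/-- `X 1, …, X n` are i.i.d. with probability mass function `(s, a) ↦ π(s) p₀(a|s)`. -/
structure IsIIDSample {Ω : Type*} [MeasurableSpace Ω] (μ : Measure Ω) (π : 𝕊 → ℝ)
    (p₀ : CondFun 𝕊) {n : ℕ} (X : Fin n → Ω → Obs 𝕊) : Prop where
  measurable : ∀ i, Measurable (X i)
  indep : iIndepFun X μ
  law : ∀ i (s : 𝕊) (a : Option (Fin N)),
    μ {ω | X i ω = (s, a)} = ENNReal.ofReal (π s * p₀ s a)

/-- `-log x` for `x ≥ 0`, with `-log 0 = +∞`. -/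
def negLog (x : ℝ) : EReal := if x = 0 then ⊤ else ((-Real.log x : ℝ) : EReal)

/-- The loss `L̂ₙ(p) = -(1/n) ∑ log p(Aᵢ|Sᵢ)`, with values in `(-∞, +∞]`. -/
def empLoss {n : ℕ} (D : Fin n → Obs 𝕊) (p : CondFun 𝕊) : EReal :=
  ((1 / n : ℝ) : EReal) * ∑ i, negLog (p (D i).1 (D i).2)

/-- `p̂` is a maximum likelihood estimator over `P`. -/
def IsMLE (P : Set (CondFun 𝕊)) {n : ℕ} (D : Fin n → Obs 𝕊) (p' : CondFun 𝕊) : Prop :=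
  p' ∈ P ∧ ∀ p ∈ P, empLoss D p' ≤ empLoss D p

/-- The uncertainty set `Ωₙ(α)` of `α`-minimizers of the loss over `P`. The infimum is `L̂ₙ(p̂ₙ)`
whenever a maximum likelihood estimator `p̂ₙ` exists, see `uncertaintySet_eq_of_isMLE`. -/
def uncertaintySet (P : Set (CondFun 𝕊)) {n : ℕ} (D : Fin n → Obs 𝕊) (α : ℝ) :
    Set (CondFun 𝕊) :=
  {p | p ∈ P ∧ empLoss D p ≤ (⨅ q ∈ P, empLoss D q) + (α : EReal)}

theorem uncertaintySet_eq_of_isMLE {P : Set (CondFun 𝕊)} {n : ℕ} {D : Fin n → Obs 𝕊}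
    {p' : CondFun 𝕊} (h : IsMLE P D p') (α : ℝ) :
    uncertaintySet P D α = {p | p ∈ P ∧ empLoss D p - empLoss D p' ≤ (α : EReal)} := by
  have h1 : (⨅ q ∈ P, empLoss D q) = empLoss D p' :=
    le_antisymm (iInf₂_le _ h.1) (le_iInf₂ h.2)
  ext p
  simp only [uncertaintySet, h1, Set.mem_ofPred_eq]
  refine and_congr_right fun _ => ?_
  rw [EReal.sub_le_iff_le_add (Or.inr (EReal.coe_ne_top _)) (Or.inr (EReal.coe_ne_bot _)),
    add_comm]

/-- The worst-case revenue of `s` over the uncertainty set. -/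
def worstValue (P : Set (CondFun 𝕊)) (r : 𝕊 → Fin N → ℝ) {n : ℕ} (D : Fin n → Obs 𝕊) (α : ℝ)
    (s : 𝕊) : ℝ :=
  sInf (value r s '' uncertaintySet P D α)

/-- `s` is an output of PASTA on the dataset `D`: it maximizes the worst-case revenue. -/
def IsPastaSolution (P : Set (CondFun 𝕊)) (r : 𝕊 → Fin N → ℝ) {n : ℕ} (D : Fin n → Obs 𝕊)
    (α : ℝ) (s : 𝕊) : Prop :=
  ∀ s', worstValue P r D α s' ≤ worstValue P r D α s

/-- The squared Hellinger distance `h²(p, q, s)`. -/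
def hellingerSqAt (p q : CondFun 𝕊) (s : 𝕊) : ℝ :=
  1 / 2 * ∑ a ∈ Finset.insertNone s.1, (√(p s a) - √(q s a)) ^ 2

/-- The generalized squared Hellinger distance `H²(p, q) = 𝔼_S[h²(p, q, S)]`, `S ∼ π`. -/
def hellingerSq (π : 𝕊 → ℝ) (p q : CondFun 𝕊) : ℝ := ∑ s, π s * hellingerSqAt p q s

/-- `B` is an `H`-bracket-cover of `P` at scale `ε`. -/
def IsBracketCover (π : 𝕊 → ℝ) (P : Set (CondFun 𝕊)) (ε : ℝ) (B : Finset (CondFun 𝕊)) : Prop :=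
  (∀ b ∈ B, ∀ s a, b s a ∈ Set.Icc (0 : ℝ) 1) ∧
  ∀ p ∈ P, ∃ b₁ ∈ B, ∃ b₂ ∈ B, √(hellingerSq π b₁ b₂) ≤ ε ∧
    ∀ s a, b₁ s a ≤ p s a ∧ p s a ≤ b₂ s a

/-- The `H`-bracketing number of `P` at scale `ε`. For `ε > 0` and a family `P` of choice models
finite covers exist, because `𝕊` and the set of items are finite. -/
def bracketingNumber (π : 𝕊 → ℝ) (P : Set (CondFun 𝕊)) (ε : ℝ) : ℕ :=
  sInf {k | ∃ B : Finset (CondFun 𝕊), IsBracketCover π P ε B ∧ B.card = k}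

/-- The function `κ`. -/
def kappa (u : ℝ) : ℝ :=
  if u = 0 then 1
  else 2 * (Real.exp (|u| / 2) - 1 - |u| / 2) / (1 - Real.exp (-u / 2)) ^ 2

/-- The constant `C₁`. -/
def C1 (τ : ℝ) : ℝ := kappa τ / 2 ^ 7

/-- The constant `C₂`. -/
def C2 (τ : ℝ) : ℝ := 2 * √(2 * kappa τ)

/-- The constant `C₃`. -/
def C3 (τ : ℝ) : ℝ := 2 * √2 * Real.exp (τ / 2)

/-- The constant `C₄`. -/
def C4 (τ : ℝ) : ℝ := kappa τ / 2 ^ 24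

/-- The constant `C₆`. -/
def C6 : ℝ := 2 * (63 / (257 * 2 ^ 14))

/-- `α` satisfies the balance equation for the sample size `n`. -/
def SolvesBalance (τ : ℝ) (π : 𝕊 → ℝ) (P : Set (CondFun 𝕊)) (n : ℕ) (α : ℝ) : Prop :=
  ∫ u in (C1 τ * α)..(C2 τ * √α), √(Real.log (bracketingNumber π P (u / C3 τ)))
    ≤ C4 τ * √n * α

end Pasta

end

noncomputable section

/-! The proof combines pessimism with a likelihood-ratio bound in Hellinger distance. If p₀ lies in
Ωₙ(α), the worst-case value of the output is at most its true value, so the regret is at most the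
largest loss of value at s⋆ over Ωₙ(α) (`value_sub_value_le_of_isPastaSolution`). Cauchy–Schwarz
bounds that loss by r_{s⋆} times the Hellinger distance at s⋆ (`value_sub_le`), and passing from the
average H² to the single assortment s⋆ costs the factor 1/π(s⋆). It remains to see that, with
probability 1 - δ, p₀ ∈ Ωₙ(α) and H² ≤ 16α on Ωₙ(α).

Both follow (`mem_uncertaintySet_and_le`) from an upper bound, uniform in p, for the sum of log((p +
p₀)/(2p₀)) over the sample. This mixture ratio dominates half the log-likelihood ratio, is bounded
below, is monotone in p, and has mean at most -H²/8.

Uniformity comes from chaining along upper brackets only (`IsDensitySample.chain`). The links are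
minima of brackets of dyadically decreasing size, so every increment is nonpositive and has a
sub-Gaussian upper tail without any boundedness (`IsDensitySample.deviation_sub_tail`). The first
link is handled by a Chernoff bound whose variance term is proportional to H² and is absorbed by
part of the drift -H²/8. The balance equation controls the total entropy of the chain, which stops
at a scale of order α₀, where replacing p by its bracket changes the mean by O(α₀). If α₀ is too
large for such a chain, the claimed bound exceeds r_{s⋆} and is trivial. -/

namespace Pasta

/-! ### Scalar inequalities for exponentials, logarithms and square roots -/

section Pointwise

theorem exp_le_of_nonpos {y : ℝ} (hy : y ≤ 0) : Real.exp y ≤ 1 + y + y ^ 2 / 2 := by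
  have h := Real.quadratic_le_exp_of_nonneg (neg_nonneg.2 hy)
  have h2 : Real.exp y * Real.exp (-y) = 1 := by rw [← Real.exp_add]; simp
  have h3 := Real.exp_pos y
  have h5 : 0 < 1 - y + y ^ 2 / 2 := by nlinarith
  have h4 : Real.exp y * (1 - y + y ^ 2 / 2) ≤ 1 := by
    rw [← h2]; gcongr; linarith
  -- The product equals 1 + y⁴/4.
  have h6 : 1 ≤ (1 + y + y ^ 2 / 2) * (1 - y + y ^ 2 / 2) := by nlinarith [sq_nonneg (y ^ 2)]
  exact le_of_mul_le_mul_right (h4.trans h6) h5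

theorem exp_le_add_sq_mul_exp {y : ℝ} (hy : 0 ≤ y) : Real.exp y ≤ 1 + y + y ^ 2 * Real.exp y := by
  have h2 : Real.exp y * Real.exp (-y) = 1 := by rw [← Real.exp_add]; simp
  have h3 := Real.exp_pos y
  have h4 := Real.add_one_le_exp (-y)
  -- The difference of the two sides is (1 + y)(1 - eʸ(1 - y)).
  nlinarith [mul_nonneg (by linarith : (0 : ℝ) ≤ 1 + y)
    (by nlinarith : (0 : ℝ) ≤ 1 - Real.exp y * (1 - y))]

/-- The square root of a mean lies between the square roots, at a comparable distance. -/
theorem sqrt_mean_sub_sq {p q : ℝ} (hp : 0 ≤ p) (hq : 0 ≤ q) :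
    (√p - √q) ^ 2 / 16 ≤ (√((p + q) / 2) - √q) ^ 2 ∧
      (√((p + q) / 2) - √q) ^ 2 ≤ (√p - √q) ^ 2 := by
  have ha := Real.sq_sqrt hp
  have hb := Real.sq_sqrt hq
  have hc := Real.sq_sqrt (by positivity : 0 ≤ (p + q) / 2)
  have ha0 := Real.sqrt_nonneg p
  have hb0 := Real.sqrt_nonneg q
  have hc0 := Real.sqrt_nonneg ((p + q) / 2)
  generalize √p = a at *
  generalize √q = b at *
  generalize √((p + q) / 2) = c at *
  subst ha hb
  -- Both bounds reduce to comparing c + b with a + b, up to a factor 2 either way.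
  have hid : (c - b) * (c + b) = (a - b) * (a + b) / 2 := by linarith
  have h1 : a + b ≤ 2 * c := by
    refine le_of_sq_le_sq ?_ (by positivity)
    nlinarith [sq_nonneg (a - b)]
  have h2 : c ≤ a + b := by
    refine le_of_sq_le_sq ?_ (by positivity)
    nlinarith [mul_nonneg ha0 hb0]
  have hsq : (c - b) ^ 2 * (c + b) ^ 2 = (a - b) ^ 2 * (a + b) ^ 2 / 4 := by
    rw [← mul_pow, hid]; ring
  rcases eq_or_lt_of_le hc0 with h0 | hc0
  · obtain rfl : a = 0 := by linarith
    obtain rfl : b = 0 := by linarith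
    simp [← h0]
  have hcb : 0 < (c + b) ^ 2 := by positivity
  constructor
  · refine le_of_mul_le_mul_right ?_ hcb
    rw [hsq]
    have : (c + b) ^ 2 ≤ 4 * (a + b) ^ 2 := by nlinarith
    nlinarith [mul_le_mul_of_nonneg_left this (sq_nonneg (a - b))]
  · refine le_of_mul_le_mul_right ?_ hcb
    rw [hsq]
    have : (a + b) ^ 2 ≤ 4 * (c + b) ^ 2 := by nlinarith
    nlinarith [mul_le_mul_of_nonneg_left this (sq_nonneg (a - b))]

/-- The log-ratio of two shifted numbers is controlled by the difference of the square roots. -/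
theorem mul_log_ratio_sq_le {c p x y : ℝ} (hc : 0 ≤ c) (hp : 0 ≤ p) (hpx : p ≤ x) (hxy : x ≤ y) :
    c * (Real.log ((x + c) / (2 * c)) - Real.log ((y + c) / (2 * c))) ^ 2
      ≤ 4 * (√p - √y) ^ 2 := by
  rcases eq_or_lt_of_le hc with h0 | hc0
  · subst h0; simp; positivity
  have hy : 0 ≤ y := by linarith
  have ha := Real.sq_sqrt (by positivity : 0 ≤ y + c)
  have hb := Real.sq_sqrt (by positivity : 0 ≤ p + c)
  have hb0 : 0 < √(p + c) := Real.sqrt_pos.2 (by positivity)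
  have hab : √(p + c) ≤ √(y + c) := Real.sqrt_le_sqrt (by linarith)
  have hL0 : Real.log ((x + c) / (2 * c)) ≤ Real.log ((y + c) / (2 * c)) :=
    Real.log_le_log (by have : 0 < x + c := by linarith
                        positivity) (by gcongr)
  have hL : Real.log ((y + c) / (2 * c)) - Real.log ((x + c) / (2 * c))
      ≤ 2 * (√(y + c) / √(p + c) - 1) := by
    have h1 : Real.log ((p + c) / (2 * c)) ≤ Real.log ((x + c) / (2 * c)) :=
      Real.log_le_log (by positivity) (by gcongr)
    have h2 : Real.log ((y + c) / (2 * c)) - Real.log ((p + c) / (2 * c))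
        = 2 * Real.log (√(y + c) / √(p + c)) := by
      have h3 : Real.log ((√(y + c) / √(p + c)) ^ 2) = 2 * Real.log (√(y + c) / √(p + c)) := by
        rw [Real.log_pow]; norm_num
      rw [← h3, ← Real.log_div (by positivity) (by positivity), div_pow, ha, hb]
      congr 1; field_simp
    have h4 := Real.log_le_sub_one_of_pos (x := √(y + c) / √(p + c)) (by positivity)
    linarith
  have h5 : √(y + c) / √(p + c) - 1 = (√(y + c) - √(p + c)) / √(p + c) := by
    field_simp
  -- Shifting both arguments by c contracts differences of square roots.
  have h6 : √(y + c) - √(p + c) ≤ √y - √p := by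
    have h7 : √p ≤ √(p + c) := Real.sqrt_le_sqrt (by linarith)
    have h8 : √y ≤ √(y + c) := Real.sqrt_le_sqrt (by linarith)
    have h9 : √p ≤ √y := Real.sqrt_le_sqrt (by linarith)
    have e1 := Real.sq_sqrt hp
    have e2 := Real.sq_sqrt hy
    by_contra! hcon
    nlinarith [Real.sqrt_nonneg p, Real.sqrt_nonneg y]
  have h10 : (Real.log ((x + c) / (2 * c)) - Real.log ((y + c) / (2 * c))) ^ 2
      ≤ (2 * ((√(y + c) - √(p + c)) / √(p + c))) ^ 2 := by
    rw [← h5, sub_sq_comm]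
    exact pow_le_pow_left₀ (by linarith) hL 2
  calc _ ≤ c * (2 * ((√(y + c) - √(p + c)) / √(p + c))) ^ 2 := by gcongr
    _ = c / (p + c) * (4 * (√(y + c) - √(p + c)) ^ 2) := by
      rw [mul_pow, div_pow, hb]; field_simp; ring
    _ ≤ 1 * (4 * (√y - √p) ^ 2) := by
      have : 0 ≤ √(y + c) - √(p + c) := by linarith
      gcongr
      rw [div_le_one (by positivity)]; linarith
    _ = _ := by ring

/-- Pointwise form of a moment generating function bound whose variance proxy is the squared
Hellinger distance. With s² = (y + c)/(2c) it is a second-order bound for s^(2l): for s ≥ 1 the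
exponential is at most √s because l ≤ 1/4, and for s < 1 the logarithm is controlled because s² ≥
1/2. -/
theorem mul_exp_log_mean_le {c y l : ℝ} (hc : 0 ≤ c) (hy : 0 ≤ y) (hl : 0 ≤ l) (hl4 : l ≤ 1 / 4) :
    c * Real.exp (l * Real.log ((y + c) / (2 * c)))
      ≤ c + l * (c * Real.log ((y + c) / (2 * c))) + 4 * l ^ 2 * (√y - √c) ^ 2 := by
  rcases eq_or_lt_of_le hc with h0 | hc0
  · subst h0; simp; positivity
  set s := √((y + c) / 2) / √c with hs
  have hsc : 0 < √c := Real.sqrt_pos.2 hc0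
  have hs0 : 0 < s := div_pos (Real.sqrt_pos.2 (by positivity)) hsc
  have hs2 : s ^ 2 = (y + c) / (2 * c) := by
    rw [hs, div_pow, Real.sq_sqrt (by positivity), Real.sq_sqrt hc]; field_simp
  have hg : Real.log ((y + c) / (2 * c)) = 2 * Real.log s := by
    rw [← hs2, Real.log_pow]; norm_num
  have hmain : c * (s - 1) ^ 2 ≤ (√y - √c) ^ 2 := by
    have : c * (s - 1) ^ 2 = (√((y + c) / 2) - √c) ^ 2 := by
      have h1 : s * √c = √((y + c) / 2) := by rw [hs]; field_simp
      rw [← h1]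
      nth_rewrite 1 [← Real.sq_sqrt hc]
      ring
    rw [this]; exact (sqrt_mean_sub_sq hy hc).2
  have hpt : Real.exp (l * (2 * Real.log s)) ≤ 1 + l * (2 * Real.log s) + 4 * l ^ 2 * (s - 1) ^ 2 := by
    rcases le_or_gt 1 s with h1 | h1
    · have hls : 0 ≤ Real.log s := Real.log_nonneg h1
      have h2 := exp_le_add_sq_mul_exp (y := l * (2 * Real.log s)) (by positivity)
      set t := √s with ht
      have ht2 : t ^ 2 = s := Real.sq_sqrt hs0.le
      have ht0 : 0 < t := Real.sqrt_pos.2 hs0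
      have hlog : Real.log s = 2 * Real.log t := by rw [← ht2, Real.log_pow]; norm_num
      have ht1 : Real.log t ≤ t - 1 := Real.log_le_sub_one_of_pos ht0
      have ht1' : 2 * Real.log t ≤ 2 * (t - 1) := by linarith
      have hexp : Real.exp (l * (2 * Real.log s)) ≤ t := by
        refine (Real.le_log_iff_exp_le ht0).1 ?_
        rw [hlog]
        nlinarith
      have h3 : (l * (2 * Real.log s)) ^ 2 * Real.exp (l * (2 * Real.log s))
          ≤ (l * (2 * (2 * (t - 1)))) ^ 2 * t := by
        rw [← hlog] at ht1'
        gcongr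
      -- This is 4t ≤ (t + 1)², since s - 1 = (t - 1)(t + 1).
      have h4 : (l * (2 * (2 * (t - 1)))) ^ 2 * t ≤ 4 * l ^ 2 * (s - 1) ^ 2 := by
        rw [← ht2]
        nlinarith [mul_nonneg (mul_nonneg (sq_nonneg l) (sq_nonneg (t - 1))) (sq_nonneg (t - 1))]
      linarith
    · have hls : Real.log s ≤ 0 := Real.log_nonpos hs0.le h1.le
      have h2 := exp_le_of_nonpos (y := l * (2 * Real.log s)) (by nlinarith)
      have h3 : 1 - 1 / s ≤ Real.log s := by simpa using Real.one_sub_inv_le_log_of_pos hs0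
      have h4 : Real.log s ^ 2 ≤ (1 / s - 1) ^ 2 := by
        rw [← neg_sq (Real.log s)]
        exact pow_le_pow_left₀ (by linarith) (by linarith) 2
      have hs12 : 1 / 2 ≤ s ^ 2 := by
        rw [hs2, div_le_div_iff₀ (by norm_num) (by positivity)]; linarith
      have h5 : (1 / s - 1) ^ 2 ≤ 2 * (s - 1) ^ 2 := by
        have : (1 / s - 1) ^ 2 = (s - 1) ^ 2 / s ^ 2 := by field_simp; ring
        rw [this, div_le_iff₀ (by positivity)]
        nlinarith [sq_nonneg (s - 1)]
      nlinarith [mul_le_mul_of_nonneg_left (h4.trans h5) (sq_nonneg l)]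
  rw [hg]
  calc _ ≤ c * (1 + l * (2 * Real.log s) + 4 * l ^ 2 * (s - 1) ^ 2) := by gcongr
    _ = c + l * (c * (2 * Real.log s)) + 4 * l ^ 2 * (c * (s - 1) ^ 2) := by ring
    _ ≤ _ := by gcongr

/-- By log x ≤ x - 1 at the square root of the ratio, with m = (p + c)/2, the left side is at most
2√(mc) - 2c = (m - c) - (√m - √c)². The linear term cancels once summed over two densities. -/
theorem mul_log_mean_le {c p : ℝ} (hc : 0 ≤ c) (hp : 0 ≤ p) :
    c * Real.log ((p + c) / (2 * c)) ≤ (p - c) / 2 - (√p - √c) ^ 2 / 16 := by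
  refine le_trans ?_ (sub_le_sub_left (sqrt_mean_sub_sq hp hc).1 _)
  have hm := Real.sq_sqrt (by positivity : 0 ≤ (p + c) / 2)
  have hcs := Real.sq_sqrt hc
  rcases eq_or_lt_of_le hc with h0 | hc0
  · subst h0; simp at *; linarith
  have hsc : 0 < √c := Real.sqrt_pos.2 hc0
  have hs0 : 0 < √((p + c) / 2) / √c := div_pos (Real.sqrt_pos.2 (by positivity)) hsc
  have h1 : Real.log ((p + c) / (2 * c)) = 2 * Real.log (√((p + c) / 2) / √c) := by
    have : (p + c) / (2 * c) = (√((p + c) / 2) / √c) ^ 2 := by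
      rw [div_pow, hm, hcs]; field_simp
    rw [this, Real.log_pow]; norm_num
  have h2 := Real.log_le_sub_one_of_pos hs0
  have h3 : c * (√((p + c) / 2) / √c) = √((p + c) / 2) * √c := by
    nth_rewrite 1 [← hcs]; field_simp
  rw [h1]
  nlinarith [mul_le_mul_of_nonneg_left h2 hc]

/-- The geometric mean of p and c is at most their arithmetic mean. -/
theorem half_log_sub_le {p c : ℝ} (hp : 0 < p) (hc : 0 < c) :
    (Real.log p - Real.log c) / 2 ≤ Real.log ((p + c) / (2 * c)) := by
  have h : Real.log (p / c) = Real.log p - Real.log c := Real.log_div hp.ne' hc.ne'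
  rw [← h, ← Real.log_sqrt (by positivity)]
  refine Real.log_le_log (Real.sqrt_pos.2 (by positivity)) (Real.sqrt_le_iff.2 ⟨by positivity, ?_⟩)
  rw [div_pow, div_le_div_iff₀ hc (by positivity)]
  nlinarith [mul_nonneg hc.le (sq_nonneg (p - c))]

end Pointwise

/-! ### The mixture log-likelihood ratio: monotonicity, moments and drift -/

section LogMixRatio

variable {ι : Type*} {f₀ : ι → ℝ}

/-- The log-likelihood ratio of the mixture `(f + f₀) / 2` and `f₀`. -/
def logMixRatio (f₀ f : ι → ℝ) (x : ι) : ℝ := Real.log ((f x + f₀ x) / (2 * f₀ x))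

theorem logMixRatio_mono (h₀ : 0 ≤ f₀) {f g : ι → ℝ} (hf : 0 ≤ f) (hfg : f ≤ g) :
    logMixRatio f₀ f ≤ logMixRatio f₀ g := by
  intro x
  unfold logMixRatio
  -- Where f₀ vanishes, both ratios are `Real.log 0 = 0` by the convention for division by zero.
  rcases eq_or_lt_of_le (h₀ x) with h | h
  · simp only [Pi.zero_apply] at h
    simp [← h]
  · have h1 : 0 ≤ f x := hf x
    simp only [Pi.zero_apply] at h
    exact Real.log_le_log (by positivity) (by gcongr; exact hfg x)

theorem half_sum_log_le_sum_logMixRatio {p : ι → ℝ} {n : ℕ} {D : Fin n → ι}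
    (hp : ∀ i, 0 < p (D i)) (h₀ : ∀ i, 0 < f₀ (D i)) :
    (∑ i, Real.log (p (D i)) - ∑ i, Real.log (f₀ (D i))) / 2 ≤ ∑ i, logMixRatio f₀ p (D i) := by
  rw [← Finset.sum_sub_distrib, Finset.sum_div]
  exact Finset.sum_le_sum fun i _ => half_log_sub_le (hp i) (h₀ i)

end LogMixRatio

section FiniteSpace

variable {ι : Type*} [Fintype ι]

/-- The squared Hellinger distance of two functions relative to the base weights `m`. -/
def weightedHellingerSq (m f g : ι → ℝ) : ℝ := 1 / 2 * ∑ x, m x * (√(f x) - √(g x)) ^ 2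

/-- The expectation of `h` under the density `f₀` relative to the base weights `m`. -/
def wexp (m f₀ h : ι → ℝ) : ℝ := ∑ x, m x * f₀ x * h x

/-- The centered empirical sum of the log-likelihood ratio. -/
def deviation (m f₀ : ι → ℝ) {n : ℕ} (D : Fin n → ι) (f : ι → ℝ) : ℝ :=
  ∑ i, logMixRatio f₀ f (D i) - n * wexp m f₀ (logMixRatio f₀ f)

variable {m f₀ : ι → ℝ}

theorem weightedHellingerSq_le_two_add (hm : 0 ≤ m) (p f g : ι → ℝ) :
    weightedHellingerSq m f g
      ≤ 2 * weightedHellingerSq m p f + 2 * weightedHellingerSq m p g := by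
  unfold weightedHellingerSq
  have : ∑ x, m x * (√(f x) - √(g x)) ^ 2
      ≤ ∑ x, (2 * (m x * (√(p x) - √(f x)) ^ 2) + 2 * (m x * (√(p x) - √(g x)) ^ 2)) := by
    refine Finset.sum_le_sum fun x _ => ?_
    nlinarith [mul_nonneg (hm x) (sq_nonneg ((√(p x) - √(f x)) + (√(p x) - √(g x))))]
  rw [Finset.sum_add_distrib, ← Finset.mul_sum, ← Finset.mul_sum] at this
  linarith

theorem weightedHellingerSq_le_of_between (hm : 0 ≤ m) {l p f u : ι → ℝ} (hlp : l ≤ p)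
    (hpf : p ≤ f) (hfu : f ≤ u) : weightedHellingerSq m p f ≤ weightedHellingerSq m l u := by
  unfold weightedHellingerSq
  gcongr 1 / 2 * ?_
  refine Finset.sum_le_sum fun x _ => mul_le_mul_of_nonneg_left ?_ (hm x)
  rw [sub_sq_comm, sub_sq_comm (√(l x))]
  have h1 := Real.sqrt_le_sqrt (hlp x)
  have h2 := Real.sqrt_le_sqrt (hpf x)
  have h3 := Real.sqrt_le_sqrt (hfu x)
  exact pow_le_pow_left₀ (by linarith) (by linarith) 2

theorem wexp_logMixRatio_sub_sq_le (hm : 0 ≤ m) (h₀ : 0 ≤ f₀) {p f g : ι → ℝ} (hp : 0 ≤ p)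
    (hpf : p ≤ f) (hfg : f ≤ g) :
    wexp m f₀ (fun x => (logMixRatio f₀ f x - logMixRatio f₀ g x) ^ 2)
      ≤ 8 * weightedHellingerSq m p g := by
  unfold wexp weightedHellingerSq logMixRatio
  rw [← mul_assoc, Finset.mul_sum]
  refine Finset.sum_le_sum fun x _ => ?_
  have := mul_le_mul_of_nonneg_left (mul_log_ratio_sq_le (h₀ x) (hp x) (hpf x) (hfg x)) (hm x)
  linarith

theorem wexp_sub (h k : ι → ℝ) : wexp m f₀ (fun x => h x - k x) = wexp m f₀ h - wexp m f₀ k := by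
  simp [wexp, mul_sub]

/-- Jensen's inequality for the square, applied to the second-moment bound; the 3 comes from 8v² ≤
(3v)². -/
theorem wexp_logMixRatio_le_add (hm : 0 ≤ m) (h₀ : 0 ≤ f₀) (hsum : ∑ x, m x * f₀ x = 1)
    {p f : ι → ℝ} (hp : 0 ≤ p) (hpf : p ≤ f) {v : ℝ} (hv : 0 ≤ v)
    (hvf : weightedHellingerSq m p f ≤ v ^ 2) :
    wexp m f₀ (logMixRatio f₀ f) ≤ wexp m f₀ (logMixRatio f₀ p) + 3 * v := by
  have h1 := wexp_logMixRatio_sub_sq_le hm h₀ hp le_rfl hpf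
  have hcs : (wexp m f₀ (fun x => logMixRatio f₀ p x - logMixRatio f₀ f x)) ^ 2
      ≤ wexp m f₀ (fun x => (logMixRatio f₀ p x - logMixRatio f₀ f x) ^ 2) := by
    exact (even_two.convexOn_pow (𝕜 := ℝ)).map_sum_le (t := Finset.univ)
      (w := fun x => m x * f₀ x) (fun x _ => mul_nonneg (hm x) (h₀ x)) hsum (fun _ _ => trivial)
  rw [wexp_sub] at hcs
  have := abs_le_of_sq_le_sq (a := wexp m f₀ (logMixRatio f₀ p) - wexp m f₀ (logMixRatio f₀ f))
    (b := 3 * v) (by nlinarith [sq_nonneg v]) (by positivity)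
  linarith [(abs_le.1 this).1]

/-- The negative drift that makes models far from f₀ unlikely to be retained. The linear terms of
the pointwise bound cancel because p and f₀ have the same total mass. -/
theorem wexp_logMixRatio_le_neg (hm : 0 ≤ m) (h₀ : 0 ≤ f₀) (hsum : ∑ x, m x * f₀ x = 1)
    {p : ι → ℝ} (hp : 0 ≤ p) (hpsum : ∑ x, m x * p x = 1) :
    wexp m f₀ (logMixRatio f₀ p) ≤ - weightedHellingerSq m p f₀ / 8 := by
  have : wexp m f₀ (logMixRatio f₀ p)
      ≤ ∑ x, ((m x * p x - m x * f₀ x) / 2 - m x * (√(p x) - √(f₀ x)) ^ 2 / 16) := by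
    refine Finset.sum_le_sum fun x _ => ?_
    have := mul_le_mul_of_nonneg_left (mul_log_mean_le (h₀ x) (hp x)) (hm x)
    unfold logMixRatio
    linarith
  rw [Finset.sum_sub_distrib, ← Finset.sum_div, ← Finset.sum_div, Finset.sum_sub_distrib,
    hpsum, hsum] at this
  unfold weightedHellingerSq
  linarith

end FiniteSpace

/-! ### Exponential tail bounds for i.i.d. samples -/

section Sample

variable {ι : Type*} [Fintype ι] [MeasurableSpace ι] [DiscreteMeasurableSpace ι]
  {Ω : Type*} [MeasurableSpace Ω] {μ : Measure Ω} [IsProbabilityMeasure μ]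
  {m f₀ : ι → ℝ} {n : ℕ} {X : Fin n → Ω → ι}

/-- `X` is an i.i.d. sample with density `f₀` relative to the base weights `m`. -/
structure IsDensitySample (μ : Measure Ω) (m f₀ : ι → ℝ) (X : Fin n → Ω → ι) : Prop where
  measurable : ∀ i, Measurable (X i)
  indep : iIndepFun X μ
  law : ∀ i x, μ.real (X i ⁻¹' {x}) = m x * f₀ x

theorem IsDensitySample.mgf_eq (hX : IsDensitySample μ m f₀ X) (i : Fin n) (h : ι → ℝ) (t : ℝ) :
    mgf (fun ω => h (X i ω)) μ t = wexp m f₀ (fun x => Real.exp (t * h x)) := by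
  have h1 : mgf (fun ω => h (X i ω)) μ t = ∫ x, Real.exp (t * h x) ∂(μ.map (X i)) :=
    (integral_map (f := fun x => Real.exp (t * h x)) (hX.measurable i).aemeasurable
      (Measurable.of_discrete).aestronglyMeasurable).symm
  have : IsProbabilityMeasure (μ.map (X i)) :=
    Measure.isProbabilityMeasure_map (hX.measurable i).aemeasurable
  rw [h1, integral_fintype (Integrable.of_finite)]
  refine Finset.sum_congr rfl fun x _ => ?_
  rw [map_measureReal_apply (hX.measurable i) (measurableSet_singleton x), hX.law, smul_eq_mul]

/-- The Chernoff bound for a sample from a finite space. -/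
theorem IsDensitySample.chernoff (hX : IsDensitySample μ m f₀ X) (h : ι → ℝ) {l : ℝ} (hl : 0 ≤ l)
    (e : ℝ) :
    μ.real {ω | e ≤ ∑ i, h (X i ω)}
      ≤ Real.exp (-l * e) * (wexp m f₀ (fun x => Real.exp (l * h x))) ^ n := by
  have hmeas : ∀ i, Measurable fun ω => h (X i ω) := fun i =>
    (Measurable.of_discrete (f := h)).comp (hX.measurable i)
  have hind : iIndepFun (fun i ω => h (X i ω)) μ :=
    hX.indep.comp (fun _ => h) fun _ => Measurable.of_discrete
  have hsum := hind.mgf_sum (t := l) hmeas Finset.univ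
  simp only [hX.mgf_eq, Finset.prod_const, Finset.card_univ, Fintype.card_fin] at hsum
  have hint : Integrable (fun ω => Real.exp (l * (∑ i, fun ω => h (X i ω)) ω)) μ := by
    simp only [Finset.sum_apply]
    obtain ⟨K, hK⟩ := (Set.finite_range fun x => h x).bddAbove
    refine Integrable.of_bound (C := Real.exp (l * (n * K))) ?_ (ae_of_all _ fun ω => ?_)
    · exact (Real.measurable_exp.comp
        ((Finset.univ.measurable_sum fun i _ => hmeas i).const_mul l)).aestronglyMeasurable
    · rw [Real.norm_eq_abs, Real.abs_exp, Real.exp_le_exp]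
      gcongr
      calc ∑ i, h (X i ω) ≤ ∑ _i : Fin n, K :=
            Finset.sum_le_sum fun i _ => hK (Set.mem_range_self _)
        _ = n * K := by simp
  have := measure_ge_le_exp_mul_mgf (μ := μ) e hl hint
  rw [hsum] at this
  simpa [Finset.sum_apply] using this

/-- The upper deviation of one log-likelihood ratio, relative to its Hellinger distance. -/
theorem IsDensitySample.deviation_tail (hX : IsDensitySample μ m f₀ X) (hm : 0 ≤ m) (h₀ : 0 ≤ f₀)
    (hsum : ∑ x, m x * f₀ x = 1) {f : ι → ℝ} (hf : 0 ≤ f) {l : ℝ} (hl : 0 ≤ l) (hl4 : l ≤ 1 / 4)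
    (a : ℝ) :
    μ.real {ω | n * (a + 8 * l * weightedHellingerSq m f f₀) ≤ deviation m f₀ (fun i => X i ω) f}
      ≤ Real.exp (-(l * n * a)) := by
  set E := wexp m f₀ (logMixRatio f₀ f) with hE
  set H := weightedHellingerSq m f f₀ with hH
  have hmgf : wexp m f₀ (fun x => Real.exp (l * logMixRatio f₀ f x))
      ≤ Real.exp (l * E + 8 * l ^ 2 * H) := by
    refine le_trans ?_ (Real.add_one_le_exp _)
    have : wexp m f₀ (fun x => Real.exp (l * logMixRatio f₀ f x))
        ≤ ∑ x, (m x * f₀ x + l * (m x * f₀ x * logMixRatio f₀ f x)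
          + 4 * l ^ 2 * (m x * (√(f x) - √(f₀ x)) ^ 2)) := by
      refine Finset.sum_le_sum fun x _ => ?_
      have := mul_le_mul_of_nonneg_left (mul_exp_log_mean_le (h₀ x) (hf x) hl hl4) (hm x)
      unfold logMixRatio
      linarith
    rw [Finset.sum_add_distrib, Finset.sum_add_distrib, ← Finset.mul_sum, ← Finset.mul_sum,
      hsum] at this
    rw [hE, hH]
    unfold weightedHellingerSq wexp at *
    linarith
  have hset : {ω | n * (a + 8 * l * H) ≤ deviation m f₀ (fun i => X i ω) f}
      = {ω | n * (a + 8 * l * H) + n * E ≤ ∑ i, logMixRatio f₀ f (X i ω)} := by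
    ext ω; simp only [Set.mem_ofPred_eq, deviation, ← hE, le_sub_iff_add_le]
  rw [hset]
  refine (hX.chernoff _ hl _).trans ?_
  have hnn : 0 ≤ wexp m f₀ (fun x => Real.exp (l * logMixRatio f₀ f x)) :=
    Finset.sum_nonneg fun x _ => mul_nonneg (mul_nonneg (hm x) (h₀ x)) (Real.exp_pos _).le
  -- The summand 8lH of the threshold cancels the variance term 8l²H exactly.
  calc _ ≤ Real.exp (-l * (n * (a + 8 * l * H) + n * E))
        * Real.exp (l * E + 8 * l ^ 2 * H) ^ n := by gcongr
    _ = _ := by rw [← Real.exp_nat_mul, ← Real.exp_add]; congr 1; ring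

/-- The upper deviation of a nonpositive increment is sub-Gaussian. -/
theorem IsDensitySample.deviation_sub_tail (hX : IsDensitySample μ m f₀ X) (hm : 0 ≤ m)
    (h₀ : 0 ≤ f₀) (hsum : ∑ x, m x * f₀ x = 1) {p f g : ι → ℝ} (hp : 0 ≤ p) (hpf : p ≤ f)
    (hfg : f ≤ g) {v : ℝ} (hv : 0 < v) (hvg : weightedHellingerSq m p g ≤ v ^ 2) {t : ℝ}
    (ht : 0 ≤ t) :
    μ.real {ω | n * t ≤ deviation m f₀ (fun i => X i ω) f - deviation m f₀ (fun i => X i ω) g}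
      ≤ Real.exp (-(n * t ^ 2 / (16 * v ^ 2))) := by
  set D : ι → ℝ := fun x => logMixRatio f₀ f x - logMixRatio f₀ g x with hD
  set E := wexp m f₀ D with hE
  -- The minimizer of -lt + 4l²v².
  set l := t / (8 * v ^ 2) with hl
  have hl0 : 0 ≤ l := by positivity
  have hmgf : wexp m f₀ (fun x => Real.exp (l * D x)) ≤ Real.exp (l * E + 4 * l ^ 2 * v ^ 2) := by
    refine le_trans ?_ (Real.add_one_le_exp _)
    have h1 : wexp m f₀ (fun x => Real.exp (l * D x))
        ≤ ∑ x, (m x * f₀ x + l * (m x * f₀ x * D x) + l ^ 2 / 2 * (m x * f₀ x * D x ^ 2)) := by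
      refine Finset.sum_le_sum fun x _ => ?_
      -- Nonpositivity gives the quadratic bound for the exponential without any lower bound on D,
      -- so no truncation is needed.
      have hDx : D x ≤ 0 := sub_nonpos.2 (logMixRatio_mono h₀ (hp.trans hpf) hfg x)
      have := mul_le_mul_of_nonneg_left
        (exp_le_of_nonpos (mul_nonpos_of_nonneg_of_nonpos hl0 hDx)) (mul_nonneg (hm x) (h₀ x))
      linarith
    rw [Finset.sum_add_distrib, Finset.sum_add_distrib, ← Finset.mul_sum, ← Finset.mul_sum,
      hsum] at h1
    have h2 := wexp_logMixRatio_sub_sq_le hm h₀ hp hpf hfg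
    have h3 : l ^ 2 / 2 * ∑ x, m x * f₀ x * D x ^ 2 ≤ l ^ 2 / 2 * (8 * v ^ 2) := by
      gcongr
      exact h2.trans (by linarith)
    have h4 : E = ∑ x, m x * f₀ x * D x := rfl
    rw [← h4] at h1
    linarith
  have hset : {ω | n * t ≤ deviation m f₀ (fun i => X i ω) f - deviation m f₀ (fun i => X i ω) g}
      = {ω | n * t + n * E ≤ ∑ i, D (X i ω)} := by
    ext ω
    simp only [Set.mem_ofPred_eq, deviation, hE, hD, wexp_sub, Finset.sum_sub_distrib]
    constructor <;> intro h <;> linarith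
  rw [hset]
  refine (hX.chernoff _ hl0 _).trans ?_
  have hnn : 0 ≤ wexp m f₀ (fun x => Real.exp (l * D x)) :=
    Finset.sum_nonneg fun x _ => mul_nonneg (mul_nonneg (hm x) (h₀ x)) (Real.exp_pos _).le
  calc _ ≤ Real.exp (-l * (n * t + n * E)) * Real.exp (l * E + 4 * l ^ 2 * v ^ 2) ^ n := by gcongr
    _ = _ := by
      rw [← Real.exp_nat_mul, ← Real.exp_add, hl]; congr 1; field_simp; ring

end Sample

/-! ### Chaining along minima of upper brackets -/

section Chaining

theorem measureReal_biUnion_le_card_mul {α Ω : Type*} [MeasurableSpace Ω] {μ : Measure Ω} [IsFiniteMeasure μ]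
    (S : Finset α) (A : α → Set Ω) {K b : ℝ} (hb : 0 ≤ b)
    (hK : (S.card : ℝ) ≤ K) (hA : ∀ f ∈ S, μ.real (A f) ≤ b) :
    μ.real (⋃ f ∈ S, A f) ≤ K * b :=
  calc μ.real (⋃ f ∈ S, A f) ≤ ∑ f ∈ S, μ.real (A f) := measureReal_biUnion_finset_le _ _
    _ ≤ ∑ _f ∈ S, b := Finset.sum_le_sum hA
    _ = S.card * b := by simp
    _ ≤ K * b := by gcongr

variable {ι : Type*}

open Classical in
/-- The minima of one function from each of `B 0, …, B j`. -/
def minFamily (B : ℕ → Finset (ι → ℝ)) : ℕ → Finset (ι → ℝ)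
  | 0 => B 0
  | j + 1 => Finset.image₂ (fun f g => f ⊓ g) (minFamily B j) (B (j + 1))

/-- The accumulated entropy of the levels `0, …, j`. -/
def cumEntropy (B : ℕ → Finset (ι → ℝ)) (j : ℕ) : ℝ :=
  ∑ i ∈ Finset.range (j + 1), Real.log (B i).card

theorem inf_mem_minFamily {B : ℕ → Finset (ι → ℝ)} {j : ℕ} {f g : ι → ℝ} (hf : f ∈ minFamily B j)
    (hg : g ∈ B (j + 1)) : f ⊓ g ∈ minFamily B (j + 1) := by
  classical exact Finset.mem_image₂_of_mem hf hg

theorem card_minFamily_le {B : ℕ → Finset (ι → ℝ)} (hB : ∀ j, (B j).Nonempty) (j : ℕ) :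
    ((minFamily B j).card : ℝ) ≤ Real.exp (cumEntropy B j) := by
  classical
  have hpos : ∀ j, (0 : ℝ) < (B j).card := fun j => by exact_mod_cast (hB j).card_pos
  induction j with
  | zero => simp [minFamily, cumEntropy, Real.exp_log (hpos 0)]
  | succ j ih =>
    rw [cumEntropy, Finset.sum_range_succ, Real.exp_add, Real.exp_log (hpos _)]
    have : ((minFamily B (j + 1)).card : ℝ) ≤ (minFamily B j).card * (B (j + 1)).card := by
      rw [minFamily]
      exact_mod_cast Finset.card_image₂_le _ _ _
    exact this.trans (mul_le_mul_of_nonneg_right ih (hpos _).le)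

variable [Fintype ι] [MeasurableSpace ι] [DiscreteMeasurableSpace ι]
  {Ω : Type*} [MeasurableSpace Ω] {μ : Measure Ω} [IsProbabilityMeasure μ]
  {m f₀ : ι → ℝ} {n : ℕ} {X : Fin n → Ω → ι} {Q : Set (ι → ℝ)} {B : ℕ → Finset (ι → ℝ)}
  {v : ℕ → ℝ}

/-- One step of the chain: passing from the minimum over the levels `0, …, j` to the minimum over
the levels `0, …, j + 1` increases the deviation by at most `n t`, uniformly over the family. -/
theorem IsDensitySample.chain_step (hX : IsDensitySample μ m f₀ X) (hm : 0 ≤ m) (h₀ : 0 ≤ f₀)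
    (hsum : ∑ x, m x * f₀ x = 1) (hQ : ∀ p ∈ Q, 0 ≤ p) (hB : ∀ j, (B j).Nonempty) (j : ℕ)
    (hv : 0 < v j) {t b : ℝ} (ht : 0 ≤ t)
    (htb : cumEntropy B (j + 1) + b ≤ n * t ^ 2 / (16 * v j ^ 2)) :
    ∃ A : Set Ω, μ.real A ≤ Real.exp (-b) ∧ ∀ ω ∉ A, ∀ p ∈ Q,
      ∀ f ∈ minFamily B j, ∀ g ∈ B (j + 1), p ≤ f → p ≤ g → weightedHellingerSq m p f ≤ v j ^ 2 →
        deviation m f₀ (fun i => X i ω) (f ⊓ g) ≤ deviation m f₀ (fun i => X i ω) f + n * t := by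
  classical
  -- The union bound runs over finitely many pairs; keeping only those above a common p ∈ Q close to
  -- the first member supplies the variance bound.
  set S := (minFamily B j ×ˢ B (j + 1)).filter
    (fun z => ∃ p ∈ Q, p ≤ z.1 ∧ p ≤ z.2 ∧ weightedHellingerSq m p z.1 ≤ v j ^ 2) with hS
  refine ⟨⋃ z ∈ S, {ω | n * t ≤ deviation m f₀ (fun i => X i ω) (z.1 ⊓ z.2)
    - deviation m f₀ (fun i => X i ω) z.1}, ?_, ?_⟩
  · have hcard : (S.card : ℝ) ≤ Real.exp (cumEntropy B (j + 1)) := by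
      have hpos : (0 : ℝ) < (B (j + 1)).card := by exact_mod_cast (hB _).card_pos
      calc (S.card : ℝ) ≤ (minFamily B j).card * (B (j + 1)).card := by
            exact_mod_cast (Finset.card_filter_le _ _).trans (Finset.card_product _ _).le
        _ ≤ Real.exp (cumEntropy B j) * (B (j + 1)).card := by
            gcongr; exact card_minFamily_le hB j
        _ = _ := by
            rw [cumEntropy, cumEntropy, Finset.sum_range_succ _ (j + 1), Real.exp_add,
              Real.exp_log hpos]
    refine (measureReal_biUnion_le_card_mul S _
      (Real.exp_pos (-(n * t ^ 2 / (16 * v j ^ 2)))).le hcard ?_).trans ?_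
    · intro z hz
      obtain ⟨p, hp, h1, h2, h3⟩ := (Finset.mem_filter.1 hz).2
      exact hX.deviation_sub_tail hm h₀ hsum (hQ p hp) (le_inf h1 h2) inf_le_left hv h3 ht
    · rw [← Real.exp_add, Real.exp_le_exp]; linarith
  · intro ω hω p hp f hf g hg h1 h2 h3
    by_contra! hcon
    refine hω (Set.mem_biUnion (x := (f, g)) ?_ ?_)
    · exact Finset.mem_coe.2 (Finset.mem_filter.2
        ⟨Finset.mk_mem_product hf hg, p, hp, h1, h2, h3⟩)
    · simp only [Set.mem_ofPred_eq]; linarith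

/-- The chain along nested upper brackets. -/
theorem IsDensitySample.chain (hX : IsDensitySample μ m f₀ X) (hm : 0 ≤ m) (h₀ : 0 ≤ f₀)
    (hsum : ∑ x, m x * f₀ x = 1) (hQ : ∀ p ∈ Q, 0 ≤ p) (hB : ∀ j, (B j).Nonempty)
    (hB0 : ∀ f ∈ B 0, 0 ≤ f) (hv : ∀ j, 0 < v j)
    (hcover : ∀ j, ∀ p ∈ Q, ∃ f ∈ B j, p ≤ f ∧ weightedHellingerSq m p f ≤ v j ^ 2)
    {a b l : ℝ} (hl : 0 ≤ l) (hl4 : l ≤ 1 / 4) (hla : cumEntropy B 0 + b ≤ l * n * a)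
    {t : ℕ → ℝ} (ht : ∀ j, 0 ≤ t j)
    (htb : ∀ j : ℕ, cumEntropy B (j + 1) + (j + 1 : ℕ) * b ≤ n * t j ^ 2 / (16 * v j ^ 2)) (J : ℕ) :
    ∃ A : Set Ω, μ.real A ≤ Real.exp (-b) + ∑ j ∈ Finset.range J, Real.exp (-b) ^ (j + 1) ∧
      ∀ ω ∉ A, ∀ p ∈ Q, ∃ f ∈ minFamily B J, p ≤ f ∧ weightedHellingerSq m p f ≤ v J ^ 2 ∧
        deviation m f₀ (fun i => X i ω) f ≤ n * (a + 16 * l * (v 0 ^ 2 + weightedHellingerSq m p f₀)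
          + ∑ j ∈ Finset.range J, t j) := by
  induction J with
  | zero =>
    refine ⟨⋃ f ∈ B 0, {ω | n * (a + 8 * l * weightedHellingerSq m f f₀)
      ≤ deviation m f₀ (fun i => X i ω) f}, ?_, ?_⟩
    · refine (measureReal_biUnion_le_card_mul (B 0) _ (Real.exp_pos (-(l * n * a))).le
        (card_minFamily_le hB 0) fun f hf =>
          hX.deviation_tail hm h₀ hsum (hB0 f hf) hl hl4 a).trans ?_
      rw [← Real.exp_add]
      simp only [Finset.range_zero, Finset.sum_empty, add_zero, Real.exp_le_exp]
      linarith
    · intro ω hω p hp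
      obtain ⟨f, hf, h1, h2⟩ := hcover 0 p hp
      refine ⟨f, hf, h1, h2, ?_⟩
      by_contra! hcon
      refine hω (Set.mem_biUnion (Finset.mem_coe.2 hf) ?_)
      simp only [Set.mem_ofPred_eq]
      refine le_trans ?_ hcon.le
      have h3 := weightedHellingerSq_le_two_add hm p f f₀
      simp only [Finset.range_zero, Finset.sum_empty, add_zero]
      have h4 : 8 * l * weightedHellingerSq m f f₀
          ≤ 16 * l * (v 0 ^ 2 + weightedHellingerSq m p f₀) := by nlinarith
      gcongr
  | succ J ih =>
    obtain ⟨A, hA, hAω⟩ := ih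
    obtain ⟨A', hA', hAω'⟩ := hX.chain_step hm h₀ hsum hQ hB J (hv J) (ht J) (htb J)
    refine ⟨A ∪ A', ?_, ?_⟩
    · refine (measureReal_union_le _ _).trans ?_
      -- The factor j + 1 in front of b makes the failure probabilities geometric.
      rw [Finset.sum_range_succ, ← add_assoc]
      refine add_le_add hA (hA'.trans_eq ?_)
      rw [← Real.exp_nat_mul]; congr 1; ring
    · intro ω hω p hp
      obtain ⟨f, hf, h1, h2, h3⟩ := hAω ω (fun h => hω (Or.inl h)) p hp
      obtain ⟨g, hg, h4, h5⟩ := hcover (J + 1) p hp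
      refine ⟨f ⊓ g, inf_mem_minFamily hf hg, le_inf h1 h4, ?_, ?_⟩
      · exact (weightedHellingerSq_le_of_between hm le_rfl (le_inf h1 h4) inf_le_right).trans h5
      · have h6 := hAω' ω (fun h => hω (Or.inr h)) p hp f hf g hg h1 h4 h2
        rw [Finset.sum_range_succ]
        linarith

/-- A uniform bound for the log-likelihood ratios over a family with bracket covers. -/
theorem IsDensitySample.sum_logMixRatio_le (hX : IsDensitySample μ m f₀ X) (hm : 0 ≤ m)
    (h₀ : 0 ≤ f₀) (hsum : ∑ x, m x * f₀ x = 1) (hQ : ∀ p ∈ Q, 0 ≤ p)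
    (hQsum : ∀ p ∈ Q, ∑ x, m x * p x = 1) (hB : ∀ j, (B j).Nonempty)
    (hB0 : ∀ f ∈ B 0, 0 ≤ f) (hv : ∀ j, 0 < v j)
    (hcover : ∀ j, ∀ p ∈ Q, ∃ f ∈ B j, p ≤ f ∧ weightedHellingerSq m p f ≤ v j ^ 2)
    {a b l : ℝ} (hl : 0 ≤ l) (hl4 : l ≤ 1 / 4) (hla : cumEntropy B 0 + b ≤ l * n * a)
    {t : ℕ → ℝ} (ht : ∀ j, 0 ≤ t j)
    (htb : ∀ j : ℕ, cumEntropy B (j + 1) + (j + 1 : ℕ) * b ≤ n * t j ^ 2 / (16 * v j ^ 2)) (J : ℕ) :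
    ∃ A : Set Ω, μ.real A ≤ Real.exp (-b) + ∑ j ∈ Finset.range J, Real.exp (-b) ^ (j + 1) ∧
      ∀ ω ∉ A, (∀ i, 0 < f₀ (X i ω)) ∧ ∀ p ∈ Q,
        ∑ i, logMixRatio f₀ p (X i ω) ≤ n * (a + 16 * l * (v 0 ^ 2 + weightedHellingerSq m p f₀)
          + ∑ j ∈ Finset.range J, t j + 3 * v J - weightedHellingerSq m p f₀ / 8) := by
  obtain ⟨A, hA, hAω⟩ := hX.chain hm h₀ hsum hQ hB hB0 hv hcover hl hl4 hla ht htb J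
  -- Almost surely no observation falls where f₀ vanishes.
  have hnull : μ.real (⋃ i, ⋃ x ∈ {x | f₀ x ≤ 0}, X i ⁻¹' {x}) = 0 := by
    rw [measureReal_eq_zero_iff]
    refine measure_iUnion_null fun i => (measure_biUnion_null_iff (Set.to_countable _)).2 ?_
    intro x hx
    rw [← measureReal_eq_zero_iff, hX.law, le_antisymm hx (h₀ x)]
    simp
  refine ⟨A ∪ ⋃ i, ⋃ x ∈ {x | f₀ x ≤ 0}, X i ⁻¹' {x}, ?_, ?_⟩
  · exact (measureReal_union_le _ _).trans (by rw [hnull, add_zero]; exact hA)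
  · intro ω hω
    refine ⟨fun i => ?_, fun p hp => ?_⟩
    · by_contra! hcon
      exact hω (Or.inr (Set.mem_iUnion.2 ⟨i, Set.mem_biUnion (x := X i ω) hcon rfl⟩))
    · obtain ⟨f, -, h1, h2, h3⟩ := hAω ω (fun h => hω (Or.inl h)) p hp
      have h4 := wexp_logMixRatio_le_add hm h₀ hsum (hQ p hp) h1 (hv J).le h2
      have h5 := wexp_logMixRatio_le_neg hm h₀ hsum (hQ p hp) (hQsum p hp)
      -- By monotonicity the bracket only increases the sum, so lower brackets play no role in the
      -- chain.
      have h6 : ∑ i, logMixRatio f₀ p (X i ω) ≤ ∑ i, logMixRatio f₀ f (X i ω) :=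
        Finset.sum_le_sum fun i _ => logMixRatio_mono h₀ (hQ p hp) h1 _
      have h7 : (n : ℝ) * wexp m f₀ (logMixRatio f₀ f)
          ≤ n * (3 * v J - weightedHellingerSq m p f₀ / 8) := by
        gcongr; linarith
      unfold deviation at h3
      linarith

end Chaining

/-! ### Comparing dyadic sums with the entropy integral -/

section DyadicSums

/-- On [u/2^(i+1), u/2^i], of length half of u/2^i, the antitone F is at least its value at the
right end. -/
theorem sum_dyadic_mul_le_integral {F : ℝ → ℝ} {lo hi u : ℝ} (hF : AntitoneOn F (Set.Icc lo hi))
    (hF0 : ∀ x, 0 ≤ F x) (hu : 0 ≤ u) (huhi : u ≤ hi) {J : ℕ} (hJ : lo ≤ u / 2 ^ (J + 1)) :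
    ∑ i ∈ Finset.range (J + 1), u / 2 ^ i * F (u / 2 ^ i) ≤ 2 * ∫ x in lo..hi, F x := by
  have hle : ∀ {i j : ℕ}, i ≤ j → u / 2 ^ j ≤ u / 2 ^ i := fun {i j} hij => by
    gcongr; norm_num
  have hint : ∀ {a b : ℝ}, lo ≤ a → a ≤ b → b ≤ hi → IntervalIntegrable F volume a b :=
    fun {a b} ha hab hb => (hF.mono (by
      rw [Set.uIcc_of_le hab]; exact Set.Icc_subset_Icc ha hb)).intervalIntegrable
  have key : ∀ K ≤ J + 1, ∑ i ∈ Finset.range K, u / 2 ^ i * F (u / 2 ^ i)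
      ≤ 2 * ∫ x in (u / 2 ^ K)..u, F x := by
    intro K
    induction K with
    | zero => intro _; simp
    | succ K ih =>
      intro hK
      have h1 : lo ≤ u / 2 ^ (K + 1) := hJ.trans (hle hK)
      have h2 : u / 2 ^ (K + 1) ≤ u / 2 ^ K := hle K.le_succ
      have h3 : u / 2 ^ K ≤ u := by simpa using hle (Nat.zero_le K)
      have h4 : ∫ x in (u / 2 ^ (K + 1))..(u / 2 ^ K), F (u / 2 ^ K)
          ≤ ∫ x in (u / 2 ^ (K + 1))..(u / 2 ^ K), F x :=
        intervalIntegral.integral_mono_on h2 (by simp) (hint h1 h2 (h3.trans huhi))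
          fun x hx => hF ⟨h1.trans hx.1, hx.2.trans (h3.trans huhi)⟩
            ⟨h1.trans h2, h3.trans huhi⟩ hx.2
      rw [intervalIntegral.integral_const, smul_eq_mul] at h4
      have h5 := intervalIntegral.integral_add_adjacent_intervals
        (hint h1 h2 (h3.trans huhi)) (hint (h1.trans h2) h3 huhi)
      have h6 : u / 2 ^ K - u / 2 ^ (K + 1) = u / 2 ^ K / 2 := by rw [pow_succ]; ring
      rw [h6] at h4
      rw [Finset.sum_range_succ, ← h5]
      linarith [ih (by omega)]
  refine (key (J + 1) le_rfl).trans ?_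
  have h1 : u / 2 ^ (J + 1) ≤ u := by simpa using hle (Nat.zero_le (J + 1))
  gcongr
  refine intervalIntegral.integral_mono_interval hJ h1 huhi (ae_of_all _ hF0)
    (hint le_rfl (hJ.trans (h1.trans huhi)) le_rfl)

/-- Exchange the sums: s i occurs only for j ≥ i - 1, and that geometric tail is at most 4v/2^i. -/
theorem sum_dyadic_mul_cum_le {s : ℕ → ℝ} (hs : ∀ i, 0 ≤ s i) {v : ℝ} (hv : 0 ≤ v) (J : ℕ) :
    ∑ j ∈ Finset.range J, v / 2 ^ j * ∑ i ∈ Finset.range (j + 2), s i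
      ≤ 4 * ∑ i ∈ Finset.range (J + 1), v / 2 ^ i * s i := by
  -- The extra term is the remaining geometric tail; with it the induction closes.
  have key : ∑ j ∈ Finset.range J, v / 2 ^ j * ∑ i ∈ Finset.range (j + 2), s i
      + 2 * (v / 2 ^ J) * ∑ i ∈ Finset.range (J + 1), s i
      ≤ 4 * ∑ i ∈ Finset.range (J + 1), v / 2 ^ i * s i := by
    induction J with
    | zero => simp; nlinarith [mul_nonneg hv (hs 0)]
    | succ J ih =>
      have h1 : v / 2 ^ (J + 1) = v / 2 ^ J / 2 := by rw [pow_succ]; ring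
      rw [Finset.sum_range_succ, Finset.sum_range_succ (n := J + 1),
        Finset.sum_range_succ (n := J + 1), h1]
      linarith
  have : 0 ≤ 2 * (v / 2 ^ J) * ∑ i ∈ Finset.range (J + 1), s i :=
    mul_nonneg (by positivity) (Finset.sum_nonneg fun i _ => hs i)
  linarith

theorem sum_succ_div_two_pow_le (J : ℕ) : ∑ j ∈ Finset.range J, ((j : ℝ) + 1) / 2 ^ j ≤ 4 := by
  have key : ∑ j ∈ Finset.range J, ((j : ℝ) + 1) / 2 ^ j + (2 * J + 4) / 2 ^ J = 4 := by
    induction J with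
    | zero => simp
    | succ J ih =>
      have h1 : (2 * ((J + 1 : ℕ) : ℝ) + 4) / 2 ^ (J + 1) + ((J : ℝ) + 1) / 2 ^ J
          = (2 * J + 4) / 2 ^ J := by
        rw [pow_succ]
        push_cast
        field_simp
        ring
      rw [Finset.sum_range_succ]
      linarith
  have : 0 ≤ (2 * (J : ℝ) + 4) / 2 ^ J := by positivity
  linarith

theorem sqrt_add_le_sqrt_add_sqrt {x y : ℝ} (hx : 0 ≤ x) (hy : 0 ≤ y) : √(x + y) ≤ √x + √y := by
  refine Real.sqrt_le_iff.2 ⟨by positivity, ?_⟩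
  nlinarith [Real.sq_sqrt hx, Real.sq_sqrt hy, Real.sqrt_nonneg x, Real.sqrt_nonneg y,
    mul_nonneg (Real.sqrt_nonneg x) (Real.sqrt_nonneg y)]

theorem sqrt_sum_le_sum_sqrt {h : ℕ → ℝ} (hh : ∀ i, 0 ≤ h i) (k : ℕ) :
    √(∑ i ∈ Finset.range k, h i) ≤ ∑ i ∈ Finset.range k, √(h i) := by
  induction k with
  | zero => simp
  | succ k ih =>
    rw [Finset.sum_range_succ, Finset.sum_range_succ]
    exact (sqrt_add_le_sqrt_add_sqrt (Finset.sum_nonneg fun i _ => hh i) (hh k)).trans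
      (by gcongr)

/-- The total of the deviations allowed along the chain. -/
theorem sum_chain_deviation_le {h : ℕ → ℝ} (hh : ∀ i, 0 ≤ h i) {v b N : ℝ} (hv : 0 ≤ v)
    (hb : 0 ≤ b) (hN : 0 < N) (J : ℕ) :
    ∑ j ∈ Finset.range J,
        4 * (v / 2 ^ j) * √((∑ i ∈ Finset.range (j + 2), h i + (j + 1 : ℕ) * b) / N)
      ≤ 16 * (∑ i ∈ Finset.range (J + 1), v / 2 ^ i * √(h i)) / √N + 16 * v * √(b / N) := by
  have hterm : ∀ j : ℕ,
      4 * (v / 2 ^ j) * √((∑ i ∈ Finset.range (j + 2), h i + (j + 1 : ℕ) * b) / N)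
      ≤ 4 / √N * (v / 2 ^ j * ∑ i ∈ Finset.range (j + 2), √(h i))
        + 4 * v * √(b / N) * (((j : ℝ) + 1) / 2 ^ j) := by
    intro j
    have h1 : √((∑ i ∈ Finset.range (j + 2), h i + (j + 1 : ℕ) * b) / N)
        ≤ (∑ i ∈ Finset.range (j + 2), √(h i)) / √N + (j + 1) * √(b / N) := by
      rw [add_div]
      refine (sqrt_add_le_sqrt_add_sqrt
        (div_nonneg (Finset.sum_nonneg fun i _ => hh i) hN.le) (by positivity)).trans ?_
      rw [Real.sqrt_div' _ hN.le, mul_div_assoc, Real.sqrt_mul (by positivity)]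
      refine add_le_add ?_ (mul_le_mul_of_nonneg_right ?_ (Real.sqrt_nonneg _))
      · gcongr; exact sqrt_sum_le_sum_sqrt hh _
      · push_cast
        exact Real.sqrt_le_iff.2 ⟨by positivity, by nlinarith [Nat.cast_nonneg (α := ℝ) j]⟩
    calc _ ≤ 4 * (v / 2 ^ j) * ((∑ i ∈ Finset.range (j + 2), √(h i)) / √N + (j + 1) * √(b / N)) := by
          gcongr
      _ = _ := by ring
  refine (Finset.sum_le_sum fun j _ => hterm j).trans ?_
  rw [Finset.sum_add_distrib, ← Finset.mul_sum, ← Finset.mul_sum]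
  have h1 := mul_le_mul_of_nonneg_left (sum_dyadic_mul_cum_le (fun i => Real.sqrt_nonneg (h i)) hv J)
    (by positivity : 0 ≤ 4 / √N)
  have h2 := mul_le_mul_of_nonneg_left (sum_succ_div_two_pow_le J)
    (by positivity : 0 ≤ 4 * v * √(b / N))
  refine (add_le_add h1 h2).trans_eq ?_
  ring

end DyadicSums

/-! ### Finite bracket covers and monotonicity of the bracketing number -/

section Bracketing

variable {N : ℕ} {𝕊 : Finset (Finset (Fin N))}

theorem IsChoiceModel.le_one {p : CondFun 𝕊} (hp : IsChoiceModel p) (s : 𝕊) (a : Option (Fin N)) :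
    p s a ≤ 1 := by
  by_cases ha : a ∈ Finset.insertNone s.1
  · rw [← hp.sum_eq_one s]
    exact Finset.single_le_sum (f := p s) (fun a _ => hp.nonneg s a) ha
  · cases a with
    | none => simp at ha
    | some a => rw [hp.eq_zero s a (by simpa using ha)]; exact zero_le_one

theorem sqrt_sub_sqrt_sq_le {x y : ℝ} (hx : 0 ≤ x) (hxy : x ≤ y) : (√x - √y) ^ 2 ≤ y - x := by
  have h1 := Real.sqrt_le_sqrt hxy
  have h2 := Real.sq_sqrt hx
  have h3 := Real.sq_sqrt (hx.trans hxy)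
  nlinarith [Real.sqrt_nonneg x]

/-- Round each probability down and up to the grid of mesh 1/M. Without a finite cover
`bracketingNumber` would be `sInf ∅ = 0`, and its monotonicity in ε would not be available. -/
theorem exists_isBracketCover {π : 𝕊 → ℝ} (hπ : IsAssortmentLaw π) {P : Set (CondFun 𝕊)}
    (hP : ∀ p ∈ P, IsChoiceModel p) {ε : ℝ} (hε : 0 < ε) :
    ∃ B : Finset (CondFun 𝕊), IsBracketCover π P ε B := by
  classical
  obtain ⟨M, hM⟩ := exists_nat_gt (((N : ℝ) + 1) / ε ^ 2)
  have hM0 : (0 : ℝ) < M := lt_of_le_of_lt (by positivity) hM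
  let F : (𝕊 → Option (Fin N) → Fin (M + 1)) → CondFun 𝕊 := fun k s a => (k s a : ℕ) / (M : ℝ)
  have hfl : ∀ p ∈ P, ∀ s a, ⌈p s a * M⌉₊ < M + 1 := fun p hp s a => by
    rw [Nat.lt_succ_iff, Nat.ceil_le]
    exact mul_le_of_le_one_left hM0.le ((hP p hp).le_one s a)
  refine ⟨Finset.univ.image F, ?_, ?_⟩
  · intro b hb s a
    obtain ⟨k, -, rfl⟩ := Finset.mem_image.1 hb
    refine ⟨by positivity, ?_⟩
    rw [div_le_one hM0]
    exact_mod_cast Nat.lt_succ_iff.1 (k s a).2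
  · intro p hp
    have hnn : ∀ s a, 0 ≤ p s a * M := fun s a => mul_nonneg ((hP p hp).nonneg s a) hM0.le
    refine ⟨F fun s a => ⟨⌊p s a * M⌋₊, (Nat.floor_le_ceil _).trans_lt (hfl p hp s a)⟩,
      Finset.mem_image_of_mem _ (Finset.mem_univ _),
      F fun s a => ⟨⌈p s a * M⌉₊, hfl p hp s a⟩,
      Finset.mem_image_of_mem _ (Finset.mem_univ _), ?_, ?_⟩
    · rw [Real.sqrt_le_left hε.le]
      have hat : ∀ s, hellingerSqAt
          (F fun s a => ⟨⌊p s a * M⌋₊, (Nat.floor_le_ceil _).trans_lt (hfl p hp s a)⟩)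
          (F fun s a => ⟨⌈p s a * M⌉₊, hfl p hp s a⟩) s ≤ ε ^ 2 := by
        intro s
        have hterm : ∀ a, (√((⌊p s a * M⌋₊ : ℝ) / M) - √((⌈p s a * M⌉₊ : ℝ) / M)) ^ 2 ≤ 1 / M := by
          intro a
          have h1 : ((⌈p s a * M⌉₊ : ℕ) : ℝ) ≤ ⌊p s a * M⌋₊ + 1 := by
            exact_mod_cast Nat.ceil_le_floor_add_one _
          have h2 : ((⌊p s a * M⌋₊ : ℕ) : ℝ) ≤ ⌈p s a * M⌉₊ := by
            exact_mod_cast Nat.floor_le_ceil _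
          refine (sqrt_sub_sqrt_sq_le (by positivity) (by gcongr)).trans ?_
          rw [← sub_div]
          gcongr
          linarith
        have h3 : ∑ a ∈ Finset.insertNone s.1,
            (√((⌊p s a * M⌋₊ : ℝ) / M) - √((⌈p s a * M⌉₊ : ℝ) / M)) ^ 2 ≤ (N + 1) * (1 / M) := by
          refine (Finset.sum_le_sum fun a _ => hterm a).trans ?_
          rw [Finset.sum_const, nsmul_eq_mul, Finset.card_insertNone]
          gcongr
          push_cast
          have := Finset.card_le_univ s.1
          rw [Fintype.card_fin] at this
          have : (s.1.card : ℝ) ≤ N := by exact_mod_cast this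
          linarith
        have h4 : ((N : ℝ) + 1) * (1 / M) ≤ ε ^ 2 := by
          rw [div_lt_iff₀ (by positivity)] at hM
          rw [mul_one_div, div_le_iff₀ hM0]
          linarith
        unfold hellingerSqAt
        have h5 : 0 ≤ ε ^ 2 := by positivity
        linarith
      calc hellingerSq π _ _ ≤ ∑ s, π s * ε ^ 2 :=
            Finset.sum_le_sum fun s _ => mul_le_mul_of_nonneg_left (hat s) (hπ.nonneg s)
        _ = ε ^ 2 := by rw [← Finset.sum_mul, hπ.sum_eq_one, one_mul]
    · intro s a
      refine ⟨?_, ?_⟩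
      · exact (div_le_iff₀ hM0).2 (Nat.floor_le (hnn s a))
      · exact (le_div_iff₀ hM0).2 (Nat.le_ceil _)

theorem exists_isBracketCover_card_eq {π : 𝕊 → ℝ} (hπ : IsAssortmentLaw π) {P : Set (CondFun 𝕊)}
    (hP : ∀ p ∈ P, IsChoiceModel p) {ε : ℝ} (hε : 0 < ε) :
    ∃ B : Finset (CondFun 𝕊), IsBracketCover π P ε B ∧ B.card = bracketingNumber π P ε := by
  obtain ⟨B, hB⟩ := exists_isBracketCover hπ hP hε
  exact Nat.sInf_mem (s := {k | ∃ B : Finset (CondFun 𝕊), IsBracketCover π P ε B ∧ B.card = k})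
    ⟨_, B, hB, rfl⟩

theorem IsBracketCover.mono {π : 𝕊 → ℝ} {P : Set (CondFun 𝕊)} {ε ε' : ℝ} (h : ε ≤ ε')
    {B : Finset (CondFun 𝕊)} (hB : IsBracketCover π P ε B) : IsBracketCover π P ε' B :=
  ⟨hB.1, fun p hp => by
    obtain ⟨b₁, h1, b₂, h2, h3, h4⟩ := hB.2 p hp
    exact ⟨b₁, h1, b₂, h2, h3.trans h, h4⟩⟩

theorem bracketingNumber_anti {π : 𝕊 → ℝ} (hπ : IsAssortmentLaw π) {P : Set (CondFun 𝕊)}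
    (hP : ∀ p ∈ P, IsChoiceModel p) {ε ε' : ℝ} (hε : 0 < ε) (h : ε ≤ ε') :
    bracketingNumber π P ε' ≤ bracketingNumber π P ε := by
  obtain ⟨B, hB, hc⟩ := exists_isBracketCover_card_eq hπ hP hε
  rw [← hc]
  exact Nat.sInf_le ⟨B, hB.mono h, rfl⟩

theorem bracketingNumber_pos {π : 𝕊 → ℝ} (hπ : IsAssortmentLaw π) {P : Set (CondFun 𝕊)}
    (hP : ∀ p ∈ P, IsChoiceModel p) (hne : P.Nonempty) {ε : ℝ} (hε : 0 < ε) :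
    0 < bracketingNumber π P ε := by
  obtain ⟨B, hB, hc⟩ := exists_isBracketCover_card_eq hπ hP hε
  obtain ⟨p, hp⟩ := hne
  obtain ⟨b, hb, -⟩ := hB.2 p hp
  rw [← hc]
  exact Finset.card_pos.2 ⟨b, hb⟩

end Bracketing

variable {N : ℕ} {𝕊 : Finset (Finset (Fin N))}

/-! ### From choice models to densities on observations -/

section Transfer

instance : Fintype (Obs 𝕊) := inferInstanceAs (Fintype (𝕊 × Option (Fin N)))

instance : DiscreteMeasurableSpace (Obs 𝕊) := ⟨fun _ => trivial⟩

/-- A conditional function, as a function of an observation. -/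
def onObs (p : CondFun 𝕊) (x : Obs 𝕊) : ℝ := p x.1 x.2

/-- The base weights `π(s)` on the observations `(s, a)` with `a ∈ s ∪ {0}`. -/
def obsWeight (π : 𝕊 → ℝ) (x : Obs 𝕊) : ℝ := if x.2 ∈ Finset.insertNone x.1.1 then π x.1 else 0

theorem onObs_injective : Function.Injective (onObs : CondFun 𝕊 → Obs 𝕊 → ℝ) := fun p q h => by
  funext s a
  exact congrFun h (s, a)

theorem obsWeight_nonneg {π : 𝕊 → ℝ} (hπ : IsAssortmentLaw π) : 0 ≤ obsWeight π := fun x => by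
  unfold obsWeight
  split_ifs
  · exact hπ.nonneg _
  · exact le_rfl

theorem sum_obsWeight_mul (π : 𝕊 → ℝ) (h : 𝕊 → Option (Fin N) → ℝ) :
    ∑ x : Obs 𝕊, obsWeight π x * h x.1 x.2
      = ∑ s, π s * ∑ a ∈ Finset.insertNone s.1, h s a := by
  have : ∑ x : Obs 𝕊, obsWeight π x * h x.1 x.2
      = ∑ s : 𝕊, ∑ a : Option (Fin N), (if a ∈ Finset.insertNone s.1 then π s else 0) * h s a :=
    Fintype.sum_prod_type (fun x : 𝕊 × Option (Fin N) =>
      (if x.2 ∈ Finset.insertNone x.1.1 then π x.1 else 0) * h x.1 x.2)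
  rw [this]
  refine Finset.sum_congr rfl fun s _ => ?_
  simp only [ite_mul, zero_mul, Finset.mul_sum]
  rw [← Finset.sum_filter]
  refine Finset.sum_congr ?_ fun _ _ => rfl
  ext a
  simp

theorem weightedHellingerSq_onObs (π : 𝕊 → ℝ) (p q : CondFun 𝕊) :
    weightedHellingerSq (obsWeight π) (onObs p) (onObs q) = hellingerSq π p q := by
  unfold weightedHellingerSq hellingerSq hellingerSqAt onObs
  rw [sum_obsWeight_mul π fun s a => (√(p s a) - √(q s a)) ^ 2, Finset.mul_sum]
  exact Finset.sum_congr rfl fun s _ => by ring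

theorem sum_obsWeight_onObs {π : 𝕊 → ℝ} (hπ : IsAssortmentLaw π) {p : CondFun 𝕊}
    (hp : IsChoiceModel p) : ∑ x, obsWeight π x * onObs p x = 1 := by
  unfold onObs
  rw [sum_obsWeight_mul π p]
  simp only [hp.sum_eq_one, mul_one, hπ.sum_eq_one]

theorem IsIIDSample.isDensitySample {Ω : Type*} [MeasurableSpace Ω] {μ : Measure Ω} {π : 𝕊 → ℝ}
    (hπ : IsAssortmentLaw π) {p₀ : CondFun 𝕊} (hp₀ : IsChoiceModel p₀) {n : ℕ}
    {X : Fin n → Ω → Obs 𝕊} (hX : IsIIDSample μ π p₀ X) :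
    IsDensitySample μ (obsWeight π) (onObs p₀) X where
  measurable := hX.measurable
  indep := hX.indep
  law i x := by
    have h1 : μ.real (X i ⁻¹' {x}) = π x.1 * p₀ x.1 x.2 := by
      have h2 : X i ⁻¹' {x} = {ω | X i ω = (x.1, x.2)} := rfl
      rw [Measure.real, h2, hX.law,
        ENNReal.toReal_ofReal (mul_nonneg (hπ.nonneg _) (hp₀.nonneg _ _))]
    rw [h1]
    unfold obsWeight onObs
    split_ifs with h
    · rfl
    -- Off the offered set p₀ vanishes too, so cutting off the base weight does not change the law.
    · rcases x with ⟨s, a⟩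
      cases a with
      | none => simp at h
      | some a => simp [hp₀.eq_zero s a (by simpa using h)]

end Transfer

/-! ### The empirical loss and its near-minimizers -/

section Loss

variable {n : ℕ} {D : Fin n → Obs 𝕊} {p : CondFun 𝕊}

/-- Nonnegative terms rule out `⊤ + ⊥ = ⊥` in `EReal`, so one impossible observation makes the loss
infinite. -/
theorem negLog_nonneg {x : ℝ} (h0 : 0 ≤ x) (h1 : x ≤ 1) : 0 ≤ negLog x := by
  unfold negLog
  split_ifs
  · exact le_top
  · exact_mod_cast neg_nonneg.2 (Real.log_nonpos h0 h1)

theorem coe_finset_sum_ereal {α : Type*} (S : Finset α) (h : α → ℝ) :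
    ((∑ i ∈ S, h i : ℝ) : EReal) = ∑ i ∈ S, (h i : EReal) := by
  classical
  induction S using Finset.induction_on with
  | empty => simp
  | insert a S ha ih => rw [Finset.sum_insert ha, Finset.sum_insert ha, EReal.coe_add, ih]

theorem empLoss_eq_coe (hp : ∀ i, onObs p (D i) ≠ 0) :
    empLoss D p = ((-(1 / n * ∑ i, Real.log (onObs p (D i))) : ℝ) : EReal) := by
  unfold empLoss
  have : ∀ i, negLog (p (D i).1 (D i).2) = ((-Real.log (onObs p (D i)) : ℝ) : EReal) := fun i =>
    if_neg (hp i)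
  simp only [this]
  rw [← coe_finset_sum_ereal, ← EReal.coe_mul, Finset.sum_neg_distrib, mul_neg]

theorem empLoss_eq_top (hn : 0 < n) (hp : IsChoiceModel p) {i : Fin n} (hi : onObs p (D i) = 0) :
    empLoss D p = ⊤ := by
  unfold empLoss
  have h1 : negLog (p (D i).1 (D i).2) = ⊤ := if_pos hi
  have h2 : negLog (p (D i).1 (D i).2) ≤ ∑ i, negLog (p (D i).1 (D i).2) :=
    Finset.single_le_sum (f := fun i => negLog (p (D i).1 (D i).2))
      (fun i _ => negLog_nonneg (hp.nonneg _ _) (hp.le_one _ _)) (Finset.mem_univ i)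
  rw [h1, top_le_iff] at h2
  rw [h2]
  exact EReal.coe_mul_top_of_pos (by positivity)

/-- A uniform bound for the log-likelihood ratios puts the true model into the uncertainty set, and
bounds the Hellinger distances in it. -/
theorem mem_uncertaintySet_and_le {P : Set (CondFun 𝕊)} (hP : ∀ p ∈ P, IsChoiceModel p)
    {p₀ : CondFun 𝕊} (hp₀ : p₀ ∈ P) (hn : 0 < n) (hD : ∀ i, 0 < onObs p₀ (D i)) {α : ℝ}
    {H : CondFun 𝕊 → ℝ} (hH : ∀ p ∈ P, 0 ≤ H p)
    (hbound : ∀ p ∈ P, ∑ i, logMixRatio (onObs p₀) (onObs p) (D i) ≤ n * (α / 2 - H p / 16)) :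
    p₀ ∈ uncertaintySet P D α ∧ ∀ p ∈ uncertaintySet P D α, H p ≤ 16 * α := by
  have hn' : (0 : ℝ) < n := by exact_mod_cast hn
  have hloss₀ := empLoss_eq_coe (p := p₀) fun i => (hD i).ne'
  have hpos : ∀ p ∈ P, (∀ i, onObs p (D i) ≠ 0) → ∀ i, 0 < onObs p (D i) := fun p hp h i =>
    lt_of_le_of_ne ((hP p hp).nonneg _ _) (h i).symm
  constructor
  · refine ⟨hp₀, ?_⟩
    rw [← EReal.sub_le_iff_le_add (Or.inl (EReal.coe_ne_bot _)) (Or.inl (EReal.coe_ne_top _))]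
    refine le_iInf₂ fun q hq => ?_
    by_cases hq0 : ∀ i, onObs q (D i) ≠ 0
    · rw [hloss₀, empLoss_eq_coe hq0, ← EReal.coe_sub, EReal.coe_le_coe_iff]
      have h1 := half_sum_log_le_sum_logMixRatio (hpos q hq hq0) hD
      have h2 := hbound q hq
      -- Half the log-likelihood ratio is at most nα/2 once the Hellinger term is dropped.
      have h3 : 1 / (n : ℝ) * (∑ i, Real.log (onObs q (D i)) - ∑ i, Real.log (onObs p₀ (D i)))
          ≤ α := by
        rw [one_div_mul_eq_div, div_le_iff₀ hn']
        nlinarith [hH q hq]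
      linarith
    · push Not at hq0
      obtain ⟨i, hi⟩ := hq0
      rw [empLoss_eq_top hn (hP q hq) hi]
      exact le_top
  · rintro p ⟨hp, hle⟩
    have h1 : empLoss D p ≤ empLoss D p₀ + (α : EReal) :=
      hle.trans (add_le_add_left (iInf₂_le _ hp₀) _)
    by_cases hp0 : ∀ i, onObs p (D i) ≠ 0
    · rw [hloss₀, empLoss_eq_coe hp0, ← EReal.coe_add, EReal.coe_le_coe_iff] at h1
      have h2 := half_sum_log_le_sum_logMixRatio (hpos p hp hp0) hD
      have h3 := hbound p hp
      have h4 : 1 / (n : ℝ) * (∑ i, Real.log (onObs p₀ (D i)) - ∑ i, Real.log (onObs p (D i)))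
          ≤ α := by linarith
      rw [one_div_mul_eq_div, div_le_iff₀ hn'] at h4
      -- Membership gives -nα/2 ≤ n(α/2 - H/16).
      have h5 : (n : ℝ) * (H p / 16) ≤ n * α := by linarith
      have := le_of_mul_le_mul_left h5 hn'
      linarith
    · push Not at hp0
      obtain ⟨i, hi⟩ := hp0
      rw [empLoss_eq_top hn (hP p hp) hi, hloss₀, ← EReal.coe_add] at h1
      exact absurd h1 (not_le.2 (EReal.coe_lt_top _))

end Loss

/-! ### Pessimism and the loss of value in Hellinger distance -/

section Regret

variable {r : 𝕊 → Fin N → ℝ}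

theorem le_maxRevenue (s : 𝕊) {a : Fin N} (ha : a ∈ s.1) : r s a ≤ maxRevenue r s :=
  le_ciSup (f := fun j : s.1 => r s j) (Set.finite_range _).bddAbove ⟨a, ha⟩

theorem maxRevenue_nonneg (hr : ∀ s : 𝕊, ∀ a ∈ s.1, 0 ≤ r s a) (s : 𝕊) : 0 ≤ maxRevenue r s :=
  Real.iSup_nonneg fun j => hr s j j.2

theorem value_nonneg (hr : ∀ s : 𝕊, ∀ a ∈ s.1, 0 ≤ r s a) {p : CondFun 𝕊} (hp : IsChoiceModel p)
    (s : 𝕊) : 0 ≤ value r s p :=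
  Finset.sum_nonneg fun a ha => mul_nonneg (hp.nonneg _ _) (hr s a ha)

theorem value_le_maxRevenue (hr : ∀ s : 𝕊, ∀ a ∈ s.1, 0 ≤ r s a) {p : CondFun 𝕊}
    (hp : IsChoiceModel p) (s : 𝕊) : value r s p ≤ maxRevenue r s := by
  have h1 := hp.sum_eq_one s
  rw [Finset.sum_insertNone] at h1
  calc value r s p ≤ ∑ a ∈ s.1, p s (some a) * maxRevenue r s :=
        Finset.sum_le_sum fun a ha => mul_le_mul_of_nonneg_left (le_maxRevenue s ha) (hp.nonneg _ _)
    _ = (∑ a ∈ s.1, p s (some a)) * maxRevenue r s := by rw [Finset.sum_mul]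
    _ ≤ 1 * maxRevenue r s := by
        gcongr
        · exact maxRevenue_nonneg hr s
        · linarith [hp.nonneg s none]
    _ = _ := one_mul _

/-- Factor |p - q| = |√p - √q|(√p + √q) and apply Cauchy–Schwarz; the squared sums of the factors
are 2h² and at most 4, hence the 8. -/
theorem value_sub_le (hr : ∀ s : 𝕊, ∀ a ∈ s.1, 0 ≤ r s a) {p q : CondFun 𝕊}
    (hp : IsChoiceModel p) (hq : IsChoiceModel q) (s : 𝕊) :
    value r s q - value r s p ≤ maxRevenue r s * √(8 * hellingerSqAt p q s) := by
  have hM := maxRevenue_nonneg hr s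
  have h1 : value r s q - value r s p
      ≤ maxRevenue r s * ∑ a ∈ Finset.insertNone s.1, |√(p s a) - √(q s a)| * (√(p s a) + √(q s a)) := by
    have habs : ∀ a, |p s a - q s a| = |√(p s a) - √(q s a)| * (√(p s a) + √(q s a)) := by
      intro a
      have hs : 0 ≤ √(p s a) + √(q s a) := by positivity
      nth_rewrite 1 [← Real.sq_sqrt (hp.nonneg s a), ← Real.sq_sqrt (hq.nonneg s a)]
      rw [sq_sub_sq, abs_mul, abs_of_nonneg hs, mul_comm]
    simp only [← habs]
    rw [Finset.sum_insertNone, mul_add, value, value, ← Finset.sum_sub_distrib]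
    refine le_add_of_nonneg_of_le (by positivity) ?_
    rw [Finset.mul_sum]
    refine Finset.sum_le_sum fun a ha => ?_
    calc q s (some a) * r s a - p s (some a) * r s a = r s a * (q s (some a) - p s (some a)) := by
          ring
      _ ≤ r s a * |p s (some a) - q s (some a)| := by
          have := hr s a ha
          gcongr
          rw [abs_sub_comm]; exact le_abs_self _
      _ ≤ _ := by gcongr; exact le_maxRevenue s ha
  refine h1.trans (mul_le_mul_of_nonneg_left (Real.le_sqrt_of_sq_le ?_) hM)
  refine (Finset.sum_mul_sq_le_sq_mul_sq _ _ _).trans ?_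
  simp only [sq_abs]
  have h2 : ∑ a ∈ Finset.insertNone s.1, (√(p s a) + √(q s a)) ^ 2 ≤ 4 := by
    have : ∑ a ∈ Finset.insertNone s.1, (√(p s a) + √(q s a)) ^ 2
        ≤ ∑ a ∈ Finset.insertNone s.1, (2 * p s a + 2 * q s a) := by
      refine Finset.sum_le_sum fun a _ => ?_
      nlinarith [Real.sq_sqrt (hp.nonneg s a), Real.sq_sqrt (hq.nonneg s a),
        sq_nonneg (√(p s a) - √(q s a))]
    rw [Finset.sum_add_distrib, ← Finset.mul_sum, ← Finset.mul_sum, hp.sum_eq_one,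
      hq.sum_eq_one] at this
    linarith
  have h3 : 0 ≤ ∑ a ∈ Finset.insertNone s.1, (√(p s a) - √(q s a)) ^ 2 :=
    Finset.sum_nonneg fun a _ => sq_nonneg _
  unfold hellingerSqAt
  nlinarith

theorem hellingerSqAt_nonneg (p q : CondFun 𝕊) (s : 𝕊) : 0 ≤ hellingerSqAt p q s :=
  mul_nonneg (by norm_num) (Finset.sum_nonneg fun _ _ => sq_nonneg _)

theorem hellingerSqAt_le_div {π : 𝕊 → ℝ} (hπ : IsAssortmentLaw π) (p q : CondFun 𝕊) {s : 𝕊}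
    (hs : 0 < π s) : hellingerSqAt p q s ≤ hellingerSq π p q / π s := by
  rw [le_div_iff₀ hs, mul_comm]
  exact Finset.single_le_sum (f := fun s => π s * hellingerSqAt p q s)
    (fun s _ => mul_nonneg (hπ.nonneg s) (hellingerSqAt_nonneg p q s)) (Finset.mem_univ s)

/-- The regret of a pessimistic solution is at most the loss of value of the competitor `s` over
the uncertainty set. -/
theorem value_sub_value_le_of_isPastaSolution (hr : ∀ s : 𝕊, ∀ a ∈ s.1, 0 ≤ r s a)
    {P : Set (CondFun 𝕊)} (hP : ∀ p ∈ P, IsChoiceModel p) {n : ℕ} {D : Fin n → Obs 𝕊} {α : ℝ}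
    {p₀ : CondFun 𝕊} (hp₀ : p₀ ∈ uncertaintySet P D α) {s' : 𝕊}
    (hs' : IsPastaSolution P r D α s') (s : 𝕊) {K : ℝ}
    (hK : ∀ p ∈ uncertaintySet P D α, value r s p₀ - value r s p ≤ K) :
    value r s p₀ - value r s' p₀ ≤ K := by
  have h1 : worstValue P r D α s' ≤ value r s' p₀ := by
    -- A real `sInf` is a lower bound only for sets bounded below; nonnegative revenues provide the
    -- bound 0.
    refine csInf_le ⟨0, ?_⟩ (Set.mem_image_of_mem _ hp₀)
    rintro _ ⟨p, hp, rfl⟩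
    exact value_nonneg hr (hP p hp.1) s'
  have h2 : value r s p₀ - K ≤ worstValue P r D α s := by
    refine le_csInf ⟨_, Set.mem_image_of_mem _ hp₀⟩ ?_
    rintro _ ⟨p, hp, rfl⟩
    linarith [hK p hp]
  linarith [hs' s]

end Regret

/-! ### Numerical consequences of the condition on τ -/

section Constants

theorem kappa_pos {τ : ℝ} (hτ : 0 < τ) : 0 < kappa τ := by
  unfold kappa
  rw [if_neg hτ.ne', abs_of_pos hτ]
  have h1 := Real.add_one_lt_exp (x := τ / 2) (by positivity)
  have h2 : Real.exp (-τ / 2) < 1 := Real.exp_lt_one_iff.2 (by linarith)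
  have h3 : 0 < 1 - Real.exp (-τ / 2) := by linarith
  have h4 : 0 < Real.exp (τ / 2) - 1 - τ / 2 := by linarith
  positivity

theorem kappa_lt_eight {τ : ℝ} (hτ : 0 < τ) (hκ : kappa τ < 8 * (1 - Real.exp (-τ)) ^ 2) :
    kappa τ < 8 := by
  have h1 : Real.exp (-τ) < 1 := Real.exp_lt_one_iff.2 (by linarith)
  have h2 := Real.exp_pos (-τ)
  nlinarith

theorem two_le_C3 {τ : ℝ} (hτ : 0 < τ) : 2 ≤ C3 τ := by
  unfold C3
  have h1 : 1 ≤ √(2 : ℝ) := Real.one_le_sqrt.2 (by norm_num)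
  have h2 : 1 ≤ Real.exp (τ / 2) := Real.one_le_exp (by positivity)
  nlinarith

/-- The coarsest scale of the chain, relative to `√α`. -/
def coarseScale (τ : ℝ) : ℝ := min (C2 τ) (C3 τ / 8)

theorem coarseScale_pos {τ : ℝ} (hτ : 0 < τ) : 0 < coarseScale τ := by
  have := kappa_pos hτ
  have := two_le_C3 hτ
  refine lt_min ?_ (by linarith)
  unfold C2
  positivity

/-- Used to make the entropy of the coarsest level a small multiple of nα₀. -/
theorem C4_sq_le {τ : ℝ} (hτ : 0 < τ) (hκ : kappa τ < 8) :
    4 * C4 τ ^ 2 ≤ coarseScale τ ^ 2 / 2 ^ 20 := by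
  have h0 := kappa_pos hτ
  have h3 := two_le_C3 hτ
  unfold coarseScale
  rcases min_choice (C2 τ) (C3 τ / 8) with h | h <;> rw [h]
  · unfold C2 C4
    rw [mul_pow, Real.sq_sqrt (by positivity)]
    nlinarith
  · unfold C4
    nlinarith

end Constants

/-! ### The uniform likelihood bound under the balance equation -/

section Likelihood

variable {Ω : Type*} [MeasurableSpace Ω] {μ : Measure Ω} [IsProbabilityMeasure μ]

theorem sum_pow_succ_le_two_mul {ρ : ℝ} (h0 : 0 ≤ ρ) (h1 : ρ ≤ 1 / 2) (J : ℕ) :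
    ∑ j ∈ Finset.range J, ρ ^ (j + 1) ≤ 2 * ρ := by
  calc ∑ j ∈ Finset.range J, ρ ^ (j + 1) ≤ ∑ j ∈ Finset.range J, (1 / 2 : ℝ) ^ j * ρ := by
        refine Finset.sum_le_sum fun j _ => ?_
        rw [pow_succ]; gcongr
    _ = (∑ j ∈ Finset.range J, (1 / 2 : ℝ) ^ j) * ρ := by rw [Finset.sum_mul]
    _ ≤ 2 * ρ := by gcongr; exact sum_geometric_two_le J

/-- The chain is run at scales v/2^j, from order √α₀ down to order α₀. The assumption `hsmall` says
that the coarsest integration scale is at least 2C₁α₀, which leaves room for a dyadic chain inside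
the range of the balance integral. -/
theorem exists_event_sum_logMixRatio_le {τ : ℝ} (hτ : 0 < τ) (hκ : kappa τ < 8)
    {π : 𝕊 → ℝ} (hπ : IsAssortmentLaw π) {P : Set (CondFun 𝕊)} (hP : ∀ p ∈ P, IsChoiceModel p)
    {p₀ : CondFun 𝕊} (hp₀ : p₀ ∈ P) {n : ℕ} (hn : 0 < n) {X : Fin n → Ω → Obs 𝕊}
    (hX : IsIIDSample μ π p₀ X) {α₀ : ℝ} (hα₀ : 0 < α₀) (hbal : SolvesBalance τ π P n α₀)
    (hsmall : 2 * C1 τ * √α₀ ≤ coarseScale τ) {δ : ℝ} (hδ : 0 < δ) (hδ1 : δ < 1) {α : ℝ}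
    (hα : α = α₀ + 1 / (C6 * n) * Real.log (4 / δ)) :
    ∃ A : Set Ω, μ.real A ≤ δ ∧ ∀ ω ∉ A, (∀ i, 0 < onObs p₀ (X i ω)) ∧ ∀ p ∈ P,
      ∑ i, logMixRatio (onObs p₀) (onObs p) (X i ω) ≤ n * (α / 2 - hellingerSq π p p₀ / 16) := by
  have hκ0 := kappa_pos hτ
  have hC3 := two_le_C3 hτ
  have hc0 := coarseScale_pos hτ
  have hc2 : coarseScale τ ≤ C2 τ := min_le_left _ _
  have hc3 : coarseScale τ ≤ C3 τ / 8 := min_le_right _ _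
  have hC1 : 0 < C1 τ := by unfold C1; positivity
  have hC18 : C1 τ ≤ 1 / 16 := by unfold C1; linarith
  have hC4 : 0 < C4 τ := by unfold C4; positivity
  have hC48 : C4 τ ≤ 1 / 2 ^ 21 := by unfold C4; linarith
  have hC6 : 0 < C6 := by unfold C6; norm_num
  have hn' : (0 : ℝ) < n := by exact_mod_cast hn
  have hsα : √α₀ ^ 2 = α₀ := Real.sq_sqrt hα₀.le
  have hsα0 : 0 < √α₀ := Real.sqrt_pos.2 hα₀
  have hlog : 0 < Real.log (4 / δ) := Real.log_pos (by rw [lt_div_iff₀ hδ]; linarith)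
  have hαα : α₀ ≤ α := by
    rw [hα]
    have : 0 ≤ 1 / (C6 * n) * Real.log (4 / δ) := by positivity
    linarith
  have hα0 : 0 < α := hα₀.trans_le hαα
  -- the scales
  set u : ℝ := coarseScale τ * √α₀ with hu
  have hu0 : 0 < u := by positivity
  set v : ℝ := u / C3 τ with hv
  have hv0 : 0 < v := by positivity
  have hv8 : v ≤ √α₀ / 8 := by
    rw [hv, div_le_iff₀ (by linarith), hu]
    nlinarith
  -- J is the last level with u/2^(J+1) ≥ C₁α₀: the dyadic intervals stay in the integration range,
  -- and v/2^J is still at most α₀/8.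
  obtain ⟨J, hJ1, hJ2⟩ := exists_nat_pow_near (x := u / (2 * (C1 τ * α₀))) (y := (2 : ℝ))
    (by rw [one_le_div (by positivity), hu]; nlinarith) (by norm_num)
  rw [le_div_iff₀ (by positivity)] at hJ1
  rw [div_lt_iff₀ (by positivity)] at hJ2
  have hlo : C1 τ * α₀ ≤ u / 2 ^ (J + 1) := by
    rw [le_div_iff₀ (by positivity), pow_succ]; linarith
  have hvJ : v / 2 ^ J ≤ α₀ / 8 := by
    rw [hv, div_div, div_le_iff₀ (by positivity)]
    have h1 : u ≤ C1 τ * α₀ * 4 * 2 ^ J := by rw [pow_succ] at hJ2; linarith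
    have h2 : C1 τ * α₀ * 4 * 2 ^ J ≤ 1 / 16 * α₀ * 4 * 2 ^ J := by gcongr
    have h3 : α₀ / 8 * (2 * 2 ^ J) ≤ α₀ / 8 * (C3 τ * 2 ^ J) := by gcongr
    linarith
  -- the brackets
  have hε : ∀ j : ℕ, 0 < v / 2 ^ j := fun j => by positivity
  choose B₀ hB₀ hB₀card using fun j : ℕ => exists_isBracketCover_card_eq hπ hP (hε j)
  classical
  set B : ℕ → Finset (Obs 𝕊 → ℝ) := fun j => (B₀ j).image onObs with hB
  have hBcard : ∀ j, (B j).card = bracketingNumber π P (u / 2 ^ j / C3 τ) := fun j => by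
    rw [hB, Finset.card_image_of_injective _ onObs_injective, hB₀card, hv, div_right_comm]
  have hBne : ∀ j, (B j).Nonempty := fun j => by
    rw [← Finset.card_pos, hBcard]
    exact bracketingNumber_pos hπ hP ⟨p₀, hp₀⟩ (by positivity)
  have hB0 : ∀ f ∈ B 0, 0 ≤ f := by
    intro f hf x
    obtain ⟨b, hb, rfl⟩ := Finset.mem_image.1 hf
    exact ((hB₀ 0).1 b hb _ _).1
  have hm := obsWeight_nonneg hπ
  have hcover : ∀ j, ∀ f ∈ onObs '' P, ∃ g ∈ B j, f ≤ g ∧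
      weightedHellingerSq (obsWeight π) f g ≤ (v / 2 ^ j) ^ 2 := by
    rintro j _ ⟨p, hp, rfl⟩
    obtain ⟨b₁, -, b₂, hb₂, h1, h2⟩ := (hB₀ j).2 p hp
    refine ⟨onObs b₂, Finset.mem_image_of_mem _ hb₂, fun x => (h2 _ _).2, ?_⟩
    rw [Real.sqrt_le_left (hε j).le] at h1
    refine (weightedHellingerSq_le_of_between (l := onObs b₁) (u := onObs b₂) hm
      (fun x => (h2 _ _).1) (fun x => (h2 _ _).2) le_rfl).trans ?_
    rwa [weightedHellingerSq_onObs]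
  -- the entropies
  set h : ℕ → ℝ := fun j => Real.log (B j).card with hh
  have hh0 : ∀ j, 0 ≤ h j := fun j => Real.log_natCast_nonneg _
  have hent : ∑ i ∈ Finset.range (J + 1), u / 2 ^ i * √(h i) ≤ 2 * (C4 τ * √n * α₀) := by
    have hanti : AntitoneOn (fun x => √(Real.log (bracketingNumber π P (x / C3 τ))))
        (Set.Icc (C1 τ * α₀) (C2 τ * √α₀)) := by
      intro x hx y hy hxy
      have hx0 : 0 < x := lt_of_lt_of_le (by positivity) hx.1
      refine Real.sqrt_le_sqrt (Real.log_le_log ?_ ?_)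
      · exact_mod_cast bracketingNumber_pos hπ hP ⟨p₀, hp₀⟩ (by have := hx0.trans_le hxy; positivity)
      · exact_mod_cast bracketingNumber_anti hπ hP (by positivity) (by gcongr)
    have h1 := sum_dyadic_mul_le_integral hanti (fun x => Real.sqrt_nonneg _) hu0.le
      (by rw [hu]; gcongr) hlo
    simp only [← hBcard] at h1
    exact h1.trans (by gcongr; exact hbal)
  have hentv : ∑ i ∈ Finset.range (J + 1), v / 2 ^ i * √(h i) ≤ C4 τ * √n * α₀ := by
    have h1 : ∑ i ∈ Finset.range (J + 1), v / 2 ^ i * √(h i)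
        = (∑ i ∈ Finset.range (J + 1), u / 2 ^ i * √(h i)) / C3 τ := by
      rw [Finset.sum_div]
      refine Finset.sum_congr rfl fun i _ => ?_
      rw [hv]; ring
    rw [h1, div_le_iff₀ (by linarith)]
    have h2 : C4 τ * √n * α₀ * 2 ≤ C4 τ * √n * α₀ * C3 τ := by gcongr
    linarith
  have hh00 : h 0 ≤ n * α₀ / 2 ^ 20 := by
    have h1 : u * √(h 0) ≤ 2 * (C4 τ * √n * α₀) := by
      refine le_trans ?_ hent
      have := Finset.single_le_sum (f := fun i => u / 2 ^ i * √(h i)) (s := Finset.range (J + 1))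
        (fun i _ => by positivity) (Finset.mem_range.2 J.succ_pos)
      simpa using this
    have h2 : coarseScale τ * √(h 0) ≤ 2 * C4 τ * √n * √α₀ := by
      refine le_of_mul_le_mul_right ?_ hsα0
      rw [hu] at h1
      nth_rewrite 2 [← hsα] at h1
      linarith
    have h3 := pow_le_pow_left₀ (by positivity) h2 2
    simp only [mul_pow, Real.sq_sqrt (hh0 0), Real.sq_sqrt hn'.le, hsα] at h3
    have h4 := C4_sq_le hτ hκ
    refine le_of_mul_le_mul_left ?_ (by positivity : 0 < coarseScale τ ^ 2)
    have h5 := mul_le_mul_of_nonneg_right h4 (by positivity : 0 ≤ (n : ℝ) * α₀)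
    linarith
  -- the chain
  set b : ℝ := C6 * n * α with hb
  have hb0 : 0 < b := by positivity
  have hρ : Real.exp (-b) ≤ δ / 4 := by
    have h1 : Real.log (4 / δ) ≤ b := by
      have : b = C6 * n * α₀ + Real.log (4 / δ) := by
        rw [hb, hα]; field_simp
      rw [this]
      have : 0 < C6 * n * α₀ := by positivity
      linarith
    calc Real.exp (-b) ≤ Real.exp (-Real.log (4 / δ)) := by gcongr
      _ = δ / 4 := by rw [Real.exp_neg, Real.exp_log (by positivity), inv_div]
  -- Chosen so that the sub-Gaussian exponent equals entropy plus (j + 1)b.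
  set t : ℕ → ℝ := fun j => 4 * (v / 2 ^ j)
    * √((∑ i ∈ Finset.range (j + 2), h i + (j + 1 : ℕ) * b) / n) with ht
  have htb : ∀ j : ℕ, cumEntropy B (j + 1) + (j + 1 : ℕ) * b
      ≤ n * t j ^ 2 / (16 * (v / 2 ^ j) ^ 2) := by
    intro j
    have h1 : 0 ≤ (∑ i ∈ Finset.range (j + 2), h i + (j + 1 : ℕ) * b) / n := by
      have := Finset.sum_nonneg fun i (_ : i ∈ Finset.range (j + 2)) => hh0 i
      positivity
    rw [ht, mul_pow, Real.sq_sqrt h1]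
    apply le_of_eq
    have := hε j
    have h2 : cumEntropy B (j + 1) = ∑ i ∈ Finset.range (j + 2), h i := rfl
    rw [h2]
    field_simp
    ring
  have hla : cumEntropy B 0 + b ≤ 1 / 2 ^ 8 * n * (α / 64) := by
    have h1 : cumEntropy B 0 = h 0 := by simp [cumEntropy, hh]
    have h2 : (n : ℝ) * α₀ ≤ n * α := by gcongr
    have h3 : 0 < (n : ℝ) * α := by positivity
    rw [h1, hb]
    unfold C6
    linarith
  obtain ⟨A, hA, hAω⟩ := (hX.isDensitySample hπ (hP p₀ hp₀)).sum_logMixRatio_le (Q := onObs '' P)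
    (B := B) (v := fun j => v / 2 ^ j) hm (fun x => (hP p₀ hp₀).nonneg _ _)
    (sum_obsWeight_onObs hπ (hP p₀ hp₀))
    (by rintro _ ⟨p, hp, rfl⟩ x; exact (hP p hp).nonneg _ _)
    (by rintro _ ⟨p, hp, rfl⟩; exact sum_obsWeight_onObs hπ (hP p hp)) hBne hB0 hε hcover
    -- With this l the coefficient 16l of H² is 1/16, half of the drift 1/8; the other half survives
    -- in the conclusion.
    (l := 1 / 2 ^ 8) (by norm_num) (by norm_num) hla (t := t) (fun j => by positivity) htb J
  refine ⟨A, ?_, fun ω hω => ⟨(hAω ω hω).1, fun p hp => ?_⟩⟩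
  · have h1 := sum_pow_succ_le_two_mul (Real.exp_pos (-b)).le (by linarith) J
    linarith
  · refine ((hAω ω hω).2 _ ⟨p, hp, rfl⟩).trans (mul_le_mul_of_nonneg_left ?_ hn'.le)
    rw [weightedHellingerSq_onObs]
    have h1 := sum_chain_deviation_le hh0 hv0.le hb0.le hn' J
    have h2 : 16 * (∑ i ∈ Finset.range (J + 1), v / 2 ^ i * √(h i)) / √n ≤ α₀ / 2 ^ 17 := by
      rw [div_le_iff₀ (Real.sqrt_pos.2 hn')]
      have : C4 τ * √n * α₀ ≤ 1 / 2 ^ 21 * √n * α₀ := by gcongr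
      linarith
    have h3 : 16 * v * √(b / n) ≤ α / 64 := by
      have h4 : √(b / n) ≤ √α / 128 := by
        refine Real.sqrt_le_iff.2 ⟨by positivity, ?_⟩
        rw [div_pow, Real.sq_sqrt hα0.le, hb, div_le_iff₀ hn']
        unfold C6
        have : 0 < α * n := by positivity
        linarith
      have h5 : v ≤ √α / 8 := hv8.trans (by gcongr)
      calc 16 * v * √(b / n) ≤ 16 * (√α / 8) * (√α / 128) := by gcongr
        _ = √α ^ 2 / 64 := by ring
        _ = α / 64 := by rw [Real.sq_sqrt hα0.le]
    have h6 : v ^ 2 ≤ α₀ / 64 := by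
      calc v ^ 2 ≤ (√α₀ / 8) ^ 2 := by gcongr
        _ = α₀ / 64 := by rw [div_pow, hsα]; norm_num
    have h7 : ∑ j ∈ Finset.range J, t j ≤ α₀ / 2 ^ 17 + α / 64 := h1.trans (add_le_add h2 h3)
    simp only [pow_zero, div_one]
    linarith

end Likelihood

end Pasta

end

/-! ### The regret bound -/

theorem mainTheorem2 (τ : ℝ) (hτ : 0 < τ)
    (hκ : Pasta.kappa τ < 8 * (1 - Real.exp (-τ)) ^ 2) :
    ∃ C5 > (0 : ℝ), ∃ C > (0 : ℝ),
      ∀ (N : ℕ) (𝕊 : Finset (Finset (Fin N))), (∀ s ∈ 𝕊, s.Nonempty) →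
      ∀ (r : 𝕊 → Fin N → ℝ), (∀ (s : 𝕊), ∀ a ∈ s.1, 0 ≤ r s a) →
      ∀ (π : 𝕊 → ℝ), Pasta.IsAssortmentLaw π →
      ∀ (P : Set (Pasta.CondFun 𝕊)), (∀ p ∈ P, Pasta.IsChoiceModel p) →
      ∀ p₀ ∈ P,
      ∀ (sStar : 𝕊), Pasta.IsOptimalAssortment r p₀ sStar → 0 < π sStar →
      ∀ (n : ℕ), 0 < n →
      ∀ (Ω : Type*) [MeasurableSpace Ω] (μ : Measure Ω) [IsProbabilityMeasure μ]
        (X : Fin n → Ω → Pasta.Obs 𝕊), Pasta.IsIIDSample μ π p₀ X →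
      ∀ α₀ > (0 : ℝ), Pasta.SolvesBalance τ π P n α₀ →
      ∀ (δ : ℝ), 0 < δ → δ < 1 →
      ∀ (α : ℝ), α = α₀ + 1 / (Pasta.C6 * n) * Real.log (C5 / δ) →
      ∀ (sHat : Ω → 𝕊),
        (∀ ω, Pasta.IsPastaSolution P r (fun i => X i ω) α (sHat ω)) →
        1 - δ ≤ μ.real {ω | Pasta.value r sStar p₀ - Pasta.value r (sHat ω) p₀
          ≤ C * Pasta.maxRevenue r sStar * √(α / π sStar)} := by
  have hκ8 := Pasta.kappa_lt_eight hτ hκ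
  have hκ0 := Pasta.kappa_pos hτ
  have hc0 := Pasta.coarseScale_pos hτ
  have hC1 : 0 < Pasta.C1 τ := by unfold Pasta.C1; positivity
  -- The 12 covers √(8·16) from the Hellinger radius; the other term serves the case of large α₀.
  refine ⟨4, by norm_num, max 12 (2 * Pasta.C1 τ / Pasta.coarseScale τ),
    lt_of_lt_of_le (by norm_num) (le_max_left _ _), ?_⟩
  intro N 𝕊 _ r hr π hπ P hP p₀ hp₀ sStar _ hπs n hn Ω _ μ _ X hX α₀ hα₀ hbal δ hδ hδ1 α hα sHat hS
  have hM := Pasta.maxRevenue_nonneg hr sStar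
  have hlog : 0 < Real.log (4 / δ) := Real.log_pos (by rw [lt_div_iff₀ hδ]; linarith)
  have hαα : α₀ ≤ α := by
    have h1 : 0 < Pasta.C6 := by unfold Pasta.C6; norm_num
    have : 0 ≤ 1 / (Pasta.C6 * n) * Real.log (4 / δ) := by positivity
    linarith
  have hα0 : 0 < α := hα₀.trans_le hαα
  have hπ1 : π sStar ≤ 1 := by
    rw [← hπ.sum_eq_one]
    exact Finset.single_le_sum (f := π) (fun s _ => hπ.nonneg s) (Finset.mem_univ _)
  rcases le_or_gt (2 * Pasta.C1 τ * √α₀) (Pasta.coarseScale τ) with hsmall | hlarge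
  · obtain ⟨A, hA, hAω⟩ := Pasta.exists_event_sum_logMixRatio_le hτ hκ8 hπ hP hp₀ hn hX hα₀ hbal
      hsmall hδ hδ1 hα
    -- Covering the whole space and using subadditivity avoids any measurability of the output
    -- `sHat` or of A.
    have hsub : Set.univ ⊆ {ω | Pasta.value r sStar p₀ - Pasta.value r (sHat ω) p₀
        ≤ max 12 (2 * Pasta.C1 τ / Pasta.coarseScale τ) * Pasta.maxRevenue r sStar
          * √(α / π sStar)} ∪ A := by
      intro ω _
      by_cases hω : ω ∈ A
      · exact Or.inr hω
      refine Or.inl ?_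
      obtain ⟨hpos, hbound⟩ := hAω ω hω
      obtain ⟨hmem, hH⟩ := Pasta.mem_uncertaintySet_and_le hP hp₀ hn hpos
        (fun p _ => Finset.sum_nonneg fun s _ =>
          mul_nonneg (hπ.nonneg s) (Pasta.hellingerSqAt_nonneg p p₀ s)) hbound
      refine Pasta.value_sub_value_le_of_isPastaSolution hr hP hmem (hS ω) sStar fun p hp => ?_
      refine (Pasta.value_sub_le hr (hP p hp.1) (hP p₀ hp₀) sStar).trans ?_
      have h1 : 8 * Pasta.hellingerSqAt p p₀ sStar ≤ 12 ^ 2 * (α / π sStar) := by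
        have h2 := (Pasta.hellingerSqAt_le_div hπ p p₀ hπs).trans
          (div_le_div_of_nonneg_right (hH p hp) hπs.le)
        rw [mul_div_assoc] at h2
        have : 0 < α / π sStar := by positivity
        linarith
      have h3 : √(8 * Pasta.hellingerSqAt p p₀ sStar) ≤ 12 * √(α / π sStar) := by
        refine (Real.sqrt_le_sqrt h1).trans_eq ?_
        rw [Real.sqrt_mul (by norm_num), Real.sqrt_sq (by norm_num)]
      calc _ ≤ Pasta.maxRevenue r sStar * (12 * √(α / π sStar)) := by gcongr
        _ = 12 * Pasta.maxRevenue r sStar * √(α / π sStar) := by ring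
        _ ≤ _ := by gcongr; exact le_max_left _ _
    have h1 : (1 : ℝ) ≤ μ.real {ω | Pasta.value r sStar p₀ - Pasta.value r (sHat ω) p₀
        ≤ max 12 (2 * Pasta.C1 τ / Pasta.coarseScale τ) * Pasta.maxRevenue r sStar
          * √(α / π sStar)} + μ.real A := by
      rw [← probReal_univ (μ := μ)]
      exact (measureReal_mono hsub).trans (measureReal_union_le _ _)
    linarith
  -- Here √α₀ is bounded below by a constant, and the regret never exceeds r_{s⋆}.
  · have hall : {ω | Pasta.value r sStar p₀ - Pasta.value r (sHat ω) p₀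
        ≤ max 12 (2 * Pasta.C1 τ / Pasta.coarseScale τ) * Pasta.maxRevenue r sStar
          * √(α / π sStar)} = Set.univ := by
      refine Set.eq_univ_of_forall fun ω => ?_
      have h1 := Pasta.value_le_maxRevenue hr (hP p₀ hp₀) sStar
      have h2 := Pasta.value_nonneg hr (hP p₀ hp₀) (sHat ω)
      have h3 : √α₀ ≤ √(α / π sStar) :=
        Real.sqrt_le_sqrt (hαα.trans (le_div_self hα0.le hπs hπ1))
      have h4 : 1 ≤ 2 * Pasta.C1 τ / Pasta.coarseScale τ * √α₀ := by
        rw [div_mul_eq_mul_div, one_le_div hc0]; exact hlarge.le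
      calc _ ≤ Pasta.maxRevenue r sStar * 1 := by linarith
        _ ≤ Pasta.maxRevenue r sStar * (2 * Pasta.C1 τ / Pasta.coarseScale τ * √α₀) := by gcongr
        _ ≤ Pasta.maxRevenue r sStar * (max 12 (2 * Pasta.C1 τ / Pasta.coarseScale τ)
            * √(α / π sStar)) := by
          gcongr
          exact le_max_right _ _
        _ = _ := by ring
    rw [hall, probReal_univ]
    linarith
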